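/- Let $\mathcal A$ be a unital (complex) $C^*$-algebra, $P_0\in\mathcal A$ an orthogonal projection, $Gr(P_0)=\{UP_0U^*: U\in\mathcal A \text{ unitary}\}$, and $P\in Gr(P_0)$. The tangent space of $Gr(P_0)$ at a point $Q$ is $T_QGr(P_0)=\{X\in\mathcal A: X^*=X,\ X=QX+XQ\}$, and the exponential map at $P$ of the canonical (reductive, equivalently horizontal) connection of $Gr(P_0)$ is $\mathrm{Exp}_P(W)=e^{[W,P]}Pe^{-[W,P]}$, $W\in T_PGr(P_0)$. Its differential at $W$ is a bounded real linear operator $D(\mathrm{Exp}_P)_W: T_PGr(P_0)\to T_{\mathrm{Exp}_P(W)}Gr(P_0)$. Let $V\in T_PGr(P_0)$ with $\|V\|=1$, put $v=[V,P]$ and let $\gamma(t)=\mathrm{Exp}_P(tV)=e^{tv}Pe^{-tv}$ be the geodesic with $\gamma(0)=P$, $\gamma'(0)=V$. The point $\gamma(t)$ is called conjugate to $P$ along $\gamma$ if $D(\mathrm{Exp}_P)_{tV}$ is not invertible, monoconjugate if $D(\mathrm{Exp}_P)_{tV}$ is not injective, and epiconjugate if it is not surjective. Represent $\mathcal A$ faithfully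 (and unitally) on a complex Hilbert space $\mathcal H$, so that $\mathcal A\subset\mathcal B(\mathcal H)$. Let $\lambda=PV(1-P)$, $|\lambda|=(\lambda^*\lambda)^{1/2}$, let $P_{|\lambda|}$ be the orthogonal projection onto the closure of the range of $|\lambda|$, let $\Omega$ be the partial isometry of the polar decomposition $\lambda=\Omega|\lambda|$ (so $\Omega=0$ on $\mathrm{ran}(|\lambda|)^\perp$), and let $\mathcal A_0=P_{|\lambda|}\mathcal A P_{|\lambda|}$. Then: 1. $Q=\gamma(\frac{\pi}{2})$ is the first conjugate point to $P$ along $\gamma$: it is conjugate to $P$, and $\gamma(t)$ is not conjugate to $P$ for $0<t<\frac{\pi}{2}$. 2. The kernel of $D(\mathrm{Exp}_P)_{\frac{\pi}{2}V}$ in $T_PGr(P_0)$ is $$\{\Omega z-z\Omega^*:\ z\in\mathcal A_0,\ |\lambda|z=z=-z^*\}.$$ 3. If $Q$ is not monoconjugate to $P$, then it is epiconjugate to $P$. 4. The operator $L_{|\lambda|}+R_{|\lambda|}-2$, that is, $z\mapsto|\lambda|z+z|\lambda|-2z$, is never invertible on $\mathcal A_0$. -/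

import Mathlib

namespace CStarGrassmannian

open scoped ContDiff

noncomputable section

/-! ### The Grassmannian of a unital C*-algebra, its tangent spaces and its connection -/

section Grassmannian

variable {A : Type*} [CStarAlgebra A]

/-- The unitary orbit `Gr(P₀)` of `P₀`. -/
def Gr (P₀ : A) : Set A := {Q | ∃ U ∈ unitary A, Q = U * P₀ * star U}

theorem isStarProjection_of_mem_Gr {P₀ P : A} (hP₀ : IsStarProjection P₀) (hP : P ∈ Gr P₀) :
    IsStarProjection P := by
  obtain ⟨U, hU, rfl⟩ := hP
  have hU1 : star U * U = 1 := (Unitary.mem_iff.1 hU).1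
  have h1 : P₀ * P₀ = P₀ := hP₀.isIdempotentElem
  have h2 : star P₀ = P₀ := hP₀.isSelfAdjoint
  refine ⟨?_, ?_⟩
  · change U * P₀ * star U * (U * P₀ * star U) = U * P₀ * star U
    calc U * P₀ * star U * (U * P₀ * star U) = U * P₀ * (star U * U) * P₀ * star U := by
          simp only [mul_assoc]
      _ = U * (P₀ * P₀) * star U := by rw [hU1]; simp only [mul_assoc, one_mul]
      _ = _ := by rw [h1]
  · change star (U * P₀ * star U) = U * P₀ * star U
    simp [h2, mul_assoc]

/-- The projection onto the `P`-co-diagonal elements along the `P`-diagonal ones. -/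
def codiag (P X : A) : A := P * X * (1 - P) + (1 - P) * X * P

/-- The tangent space `T_P Gr(P₀)`: the self-adjoint `P`-co-diagonal elements, that is, the
self-adjoint `X` with `X = P X + X P`. -/
def tangentSpace (P : A) : Submodule ℝ A where
  carrier := {X | star X = X ∧ P * X + X * P = X}
  add_mem' := by
    rintro X Y ⟨h1, h2⟩ ⟨h3, h4⟩
    refine ⟨by rw [star_add, h1, h3], ?_⟩
    calc P * (X + Y) + (X + Y) * P = (P * X + X * P) + (P * Y + Y * P) := by noncomm_ring
      _ = X + Y := by rw [h2, h4]
  zero_mem' := by simp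
  smul_mem' := by
    rintro c X ⟨h1, h2⟩
    refine ⟨by simp [h1], ?_⟩
    rw [mul_smul_comm, smul_mul_assoc, ← smul_add, h2]

theorem mem_tangentSpace {P X : A} :
    X ∈ tangentSpace P ↔ star X = X ∧ P * X + X * P = X := Iff.rfl

theorem mem_tangentSpace_iff_codiag {P X : A} (hP : IsStarProjection P) :
    X ∈ tangentSpace P ↔ star X = X ∧ codiag P X = X := by
  have h1 : P * P = P := hP.isIdempotentElem
  rw [mem_tangentSpace]
  refine and_congr_right fun _ => ⟨fun h => ?_, fun h => ?_⟩
  · have h3 : P * X * P = 0 := by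
      have h4 : P * (P * X + X * P) * P = P * X * P := by rw [h]
      have h5 : P * (P * X + X * P) * P = P * X * P + P * X * P := by
        calc P * (P * X + X * P) * P = (P * P) * X * P + P * X * (P * P) := by noncomm_ring
          _ = _ := by rw [h1]
      rw [h5] at h4
      simpa using h4
    calc codiag P X = (P * X + X * P) - 2 • (P * X * P) := by unfold codiag; noncomm_ring
      _ = X := by rw [h, h3]; simp
  · calc P * X + X * P = P * codiag P X + codiag P X * P := by rw [h]
      _ = (P * P) * X + X * (P * P) + (P * X * P - (P * P) * X * P) +
            (P * X * P - P * X * (P * P)) - ((P * P) * X * P - P * X * P) -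
            (P * X * (P * P) - P * X * P) - 2 • (P * X * P) := by
          unfold codiag; noncomm_ring
      _ = codiag P X := by rw [h1]; unfold codiag; noncomm_ring
      _ = X := h

/-- The skew-adjoint co-diagonal element `v = [V, P]` attached to a tangent vector `V`. -/
def gen (P V : A) : A := V * P - P * V

/-- The exponential map `Exp_P : T_P Gr(P₀) → Gr(P₀)` of the connection,
`Exp_P(V) = e^v P e^{-v}` with `v = [V, P]`. -/
def grExp (P : A) (V : tangentSpace P) : A :=
  NormedSpace.exp (gen P V) * P * NormedSpace.exp (-gen P V)

/-- The geodesic `γ(t) = Exp_P(tV)` starting at `P` with speed `V`. -/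
def geodesic (P : A) (V : tangentSpace P) (t : ℝ) : A := grExp P (t • V)

/-- The covariant derivative of the field `μ` along the curve `γ`: differentiate and project
to the tangent space. -/
def covDeriv (γ μ : ℝ → A) (t : ℝ) : A := codiag (γ t) (deriv μ t)

/-- Geodesics of the connection: smooth curves of projections with `D_t γ' = 0`. -/
structure IsGeodesic (γ : ℝ → A) : Prop where
  smooth : ContDiff ℝ ∞ γ
  isStarProjection : ∀ t, IsStarProjection (γ t)
  covDeriv_eq_zero : ∀ t, covDeriv γ (deriv γ) t = 0

theorem star_gen {P V : A} (hP : IsStarProjection P) (hV : V ∈ tangentSpace P) :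
    star (gen P V) = -gen P V := by
  have h2 : star P = P := hP.isSelfAdjoint
  simp [gen, h2, hV.1]

theorem exp_gen_mem_unitary {P V : A} (hP : IsStarProjection P) (hV : V ∈ tangentSpace P) :
    NormedSpace.exp (gen P V) ∈ unitary A := by
  have hs : star (NormedSpace.exp (gen P V)) = NormedSpace.exp (-gen P V) := by
    rw [NormedSpace.star_exp, star_gen hP hV]
  let +nondep : NormedAlgebra ℚ A := .restrictScalars ℚ ℂ A
  rw [Unitary.mem_iff, hs, ← NormedSpace.exp_add_of_commute (Commute.neg_left (Commute.refl _)),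
    ← NormedSpace.exp_add_of_commute (Commute.neg_right (Commute.refl _))]
  simp

theorem grExp_mem_Gr {P₀ P : A} (hP₀ : IsStarProjection P₀) (hP : P ∈ Gr P₀)
    (V : tangentSpace P) : grExp P V ∈ Gr P₀ := by
  have hP' := isStarProjection_of_mem_Gr hP₀ hP
  obtain ⟨U, hU, rfl⟩ := hP
  refine ⟨_, mul_mem (exp_gen_mem_unitary hP' V.2) hU, ?_⟩
  rw [star_mul, NormedSpace.star_exp, star_gen hP' V.2]
  simp only [grExp, mul_assoc]

theorem isStarProjection_grExp {P : A} (hP : IsStarProjection P) (V : tangentSpace P) :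
    IsStarProjection (grExp P V) :=
  isStarProjection_of_mem_Gr hP
    (grExp_mem_Gr hP ⟨1, one_mem _, by simp⟩ V)

theorem contDiff_grExp (P : A) : ContDiff ℝ ∞ (grExp P) := by
  have he : ContDiff ℝ ∞ (NormedSpace.exp : A → A) :=
    contDiff_iff_contDiffAt.2 fun x => (NormedSpace.exp_analytic (𝕂 := ℝ) x).contDiffAt
  have hs : ContDiff ℝ ∞ fun V : tangentSpace P => (V : A) :=
    (tangentSpace P).subtypeL.contDiff
  have hc : ContDiff ℝ ∞ fun _ : tangentSpace P => P := contDiff_const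
  have hg : ContDiff ℝ ∞ fun V : tangentSpace P => gen P V :=
    (hs.mul hc).sub (hc.mul hs)
  exact ((he.comp hg).mul hc).mul (he.comp hg.neg)

/-- The derivative of `Exp_P` at `W` takes values in the tangent space at `Exp_P(W)`. -/
theorem fderiv_grExp_mem {P : A} (hP : IsStarProjection P) (W X : tangentSpace P) :
    fderiv ℝ (grExp P) W X ∈ tangentSpace (grExp P W) := by
  have hd : HasFDerivAt (grExp P) (fderiv ℝ (grExp P) W) W :=
    ((contDiff_grExp P).differentiable (by simp) W).hasFDerivAt
  constructor
  · have h1 := hd.star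
    have h2 : (fun V => star (grExp P V)) = grExp P :=
      funext fun V => (isStarProjection_grExp hP V).isSelfAdjoint
    rw [h2] at h1
    have h3 := congrArg (fun L : tangentSpace P →L[ℝ] A => L X) (h1.unique hd)
    simpa using h3
  · have h1 := HasFDerivAt.mul' (𝕜 := ℝ) hd hd
    have h2 : grExp P * grExp P = grExp P :=
      funext fun V => (isStarProjection_grExp hP V).isIdempotentElem
    rw [h2] at h1
    have h3 := congrArg (fun L : tangentSpace P →L[ℝ] A => L X) (h1.unique hd)
    simpa using h3

/-- The differential `D(Exp_P)_W : T_P Gr(P₀) → T_{Exp_P(W)} Gr(P₀)`. -/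
def dExp {P : A} (hP : IsStarProjection P) (W : tangentSpace P) :
    tangentSpace P →L[ℝ] tangentSpace (grExp P W) :=
  (fderiv ℝ (grExp P) W).codRestrict (tangentSpace (grExp P W)) (fderiv_grExp_mem hP W)

/-- `γ(t) = Exp_P(tV)` is conjugate to `P` along `γ`. -/
def IsConjugate {P : A} (hP : IsStarProjection P) (V : tangentSpace P) (t : ℝ) : Prop :=
  ¬ (dExp hP (t • V)).IsInvertible

/-- `γ(t) = Exp_P(tV)` is monoconjugate to `P` along `γ`. -/
def IsMonoconjugate {P : A} (hP : IsStarProjection P) (V : tangentSpace P) (t : ℝ) : Prop :=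
  ¬ Function.Injective (dExp hP (t • V))

/-- `γ(t) = Exp_P(tV)` is epiconjugate to `P` along `γ`. -/
def IsEpiconjugate {P : A} (hP : IsStarProjection P) (V : tangentSpace P) (t : ℝ) : Prop :=
  ¬ Function.Surjective (dExp hP (t • V))

/-- `γ(t₀)`, with `t₀ > 0`, is the first conjugate point to `P` along `γ`. -/
def IsFirstConjugate {P : A} (hP : IsStarProjection P) (V : tangentSpace P) (t₀ : ℝ) : Prop :=
  0 < t₀ ∧ IsConjugate hP V t₀ ∧ ∀ t, 0 < t → t < t₀ → ¬ IsConjugate hP V t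

/-! `geodesic P V` is the unique geodesic of the connection starting at `P` with speed `V`. -/

theorem geodesic_eq (P : A) (V : tangentSpace P) (t : ℝ) :
    geodesic P V t =
      NormedSpace.exp (t • gen P V) * P * NormedSpace.exp (t • (-gen P V)) := by
  simp [geodesic, grExp, gen, smul_sub]

theorem hasDerivAt_conj (P v : A) (t : ℝ) :
    HasDerivAt (fun t : ℝ => NormedSpace.exp (t • v) * P * NormedSpace.exp (t • (-v)))
      (NormedSpace.exp (t • v) * (v * P - P * v) * NormedSpace.exp (t • (-v))) t := by
  have h := ((hasDerivAt_exp_smul_const v t).mul_const P).mul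
    (hasDerivAt_exp_smul_const' (-v) t)
  have e : NormedSpace.exp (t • v) * (v * P - P * v) * NormedSpace.exp (t • (-v)) =
      NormedSpace.exp (t • v) * v * P * NormedSpace.exp (t • (-v)) +
        NormedSpace.exp (t • v) * P * (-v * NormedSpace.exp (t • (-v))) := by
    generalize NormedSpace.exp (t • (-v)) = F
    noncomm_ring
  rw [e]
  exact h

theorem gen_gen {P V : A} (hV : P * V + V * P = V) (hP : P * P = P) :
    gen P V * P - P * gen P V = V := by
  have h3 : P * V * P = 0 := by
    have h4 : P * (P * V + V * P) * P = P * V * P := by rw [hV]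
    have h5 : P * (P * V + V * P) * P = P * V * P + P * V * P := by
      calc P * (P * V + V * P) * P = (P * P) * V * P + P * V * (P * P) := by noncomm_ring
        _ = _ := by rw [hP]
    rw [h5] at h4
    simpa using h4
  calc gen P V * P - P * gen P V = (P * P) * V + V * (P * P) - 2 • (P * V * P) := by
        unfold gen; noncomm_ring
    _ = V := by rw [hP, h3, hV]; simp

theorem isGeodesic_geodesic {P : A} (hP : IsStarProjection P) (V : tangentSpace P) :
    IsGeodesic (geodesic P V) ∧ geodesic P V 0 = P ∧ deriv (geodesic P V) 0 = V := by
  have hPP : P * P = P := hP.isIdempotentElem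
  have hV : P * (V : A) + V * P = V := V.2.2
  have hγ : geodesic P V = fun t : ℝ =>
      NormedSpace.exp (t • gen P V) * P * NormedSpace.exp (t • (-gen P V)) :=
    funext (geodesic_eq P V)
  have hd : deriv (geodesic P V) = fun t : ℝ =>
      NormedSpace.exp (t • gen P V) * V * NormedSpace.exp (t • (-gen P V)) := by
    funext t
    rw [hγ, (hasDerivAt_conj P (gen P V) t).deriv, gen_gen hV hPP]
  refine ⟨⟨?_, fun t => isStarProjection_grExp hP _, fun t => ?_⟩, ?_, ?_⟩
  · exact (contDiff_grExp P).comp (contDiff_id.smul contDiff_const)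
  · have hE : NormedSpace.exp (t • (-gen P V)) * NormedSpace.exp (t • gen P V) = 1 := by
      let +nondep : NormedAlgebra ℚ A := .restrictScalars ℚ ℂ A
      rw [← NormedSpace.exp_add_of_commute]
      · simp
      · exact ((Commute.refl (gen P V)).neg_left.smul_left t).smul_right t
    rw [covDeriv, hd, (hasDerivAt_conj (V : A) (gen P V) t).deriv, geodesic_eq]
    generalize NormedSpace.exp (t • (-gen P V)) = F at *
    generalize NormedSpace.exp (t • gen P V) = E at *
    have hc : P * (gen P V * V - V * gen P V) = (gen P V * V - V * gen P V) * P := by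
      have h1 : (V : A) * P = V - P * V := by
        rw [eq_sub_iff_add_eq, add_comm]; exact hV
      have h2 : P * ((V : A) * V) = V * V * P := by
        calc P * ((V : A) * V) = (P * V + V * P) * V - V * P * V := by noncomm_ring
          _ = (V : A) * (P * V + V * P) - V * P * V := by rw [hV]
          _ = V * V * P := by noncomm_ring
      have h3 : (V : A) * P * V = V * V - P * (V * V) := by
        rw [h1]; noncomm_ring
      have h4 : gen P V * V - V * gen P V = 2 • (V * V) - 4 • (P * ((V : A) * V)) := by
        calc gen P V * V - V * gen P V
            = 2 • ((V : A) * P * V) - P * (V * V) - V * V * P := by unfold gen; noncomm_ring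
          _ = _ := by rw [h3, ← h2]; noncomm_ring
      rw [h4]
      calc P * (2 • ((V : A) * V) - 4 • (P * ((V : A) * V)))
          = 2 • (P * ((V : A) * V)) - 4 • ((P * P) * (V * V)) := by noncomm_ring
        _ = 2 • ((V : A) * V * P) - 4 • (P * ((V : A) * V * P)) := by
            rw [← h2, ← mul_assoc P P]
        _ = _ := by noncomm_ring
    generalize gen P V * V - V * gen P V = D at *
    have e1 : E * P * F * (E * D * F) = E * (P * D) * F := by
      calc E * P * F * (E * D * F) = E * P * (F * E) * D * F := by noncomm_ring
        _ = _ := by rw [hE]; noncomm_ring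
    have e2 : (E * D * F) * (E * P * F) = E * (D * P) * F := by
      calc E * D * F * (E * P * F) = E * D * (F * E) * P * F := by noncomm_ring
        _ = _ := by rw [hE]; noncomm_ring
    have e3 : (E * D * F) * (E * P * F) = E * P * F * (E * D * F) := by rw [e1, e2, hc]
    have e4 : E * P * F * (E * P * F) = E * P * F := by
      calc E * P * F * (E * P * F) = E * P * (F * E) * P * F := by noncomm_ring
        _ = E * (P * P) * F := by rw [hE]; noncomm_ring
        _ = _ := by rw [hPP]
    generalize E * P * F = Q at *
    generalize E * D * F = Y at *
    calc codiag Q Y = Q * Y + Y * Q - 2 • (Q * (Y * Q)) := by unfold codiag; noncomm_ring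
      _ = Q * Y + Q * Y - 2 • ((Q * Q) * Y) := by rw [e3]; noncomm_ring
      _ = 0 := by rw [e4]; noncomm_ring
  · simp [geodesic_eq]
  · rw [hd]; simp

/-- The acceleration of a geodesic as a function of position and velocity. -/
theorem IsGeodesic.deriv_deriv {γ : ℝ → A} (h : IsGeodesic γ) (t : ℝ) :
    deriv (deriv γ) t = 2 • ((1 - γ t) * (deriv γ t * deriv γ t) * (1 - γ t)
      - γ t * (deriv γ t * deriv γ t) * γ t) := by
  have hs : ContDiff ℝ 2 γ := contDiff_infty.1 h.smooth 2
  have hd1 : ∀ t, HasDerivAt γ (deriv γ t) t := fun t =>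
    (hs.differentiable (by norm_num) t).hasDerivAt
  have hs' : ContDiff ℝ 1 (deriv γ) := by
    have := (contDiff_succ_iff_deriv (n := 1) (f := γ) (𝕜 := ℝ)).1 (by simpa using! hs)
    exact this.2.2
  have hd2 : ∀ t, HasDerivAt (deriv γ) (deriv (deriv γ) t) t := fun t =>
    (hs'.differentiable (by norm_num) t).hasDerivAt
  have hi : ∀ t, γ t * γ t = γ t := fun t => (h.isStarProjection t).isIdempotentElem
  have e1 : ∀ t, deriv γ t * γ t + γ t * deriv γ t = deriv γ t := fun t => by
    have h1 := (hd1 t).mul (hd1 t)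
    have h2 : γ * γ = γ := funext hi
    rw [h2] at h1
    exact h1.unique (hd1 t)
  have e2 : (deriv (deriv γ) t * γ t + deriv γ t * deriv γ t) +
      (deriv γ t * deriv γ t + γ t * deriv (deriv γ) t) = deriv (deriv γ) t := by
    have h1 := ((hd2 t).mul (hd1 t)).add ((hd1 t).mul (hd2 t))
    have h2 : deriv γ * γ + γ * deriv γ = deriv γ := funext e1
    rw [h2] at h1
    exact h1.unique (hd2 t)
  have hc := h.covDeriv_eq_zero t
  have hi := hi t
  unfold covDeriv at hc
  generalize deriv (deriv γ) t = Y at *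
  generalize deriv γ t = X at *
  generalize γ t = Q at *
  have hY : Y = Q * Y * Q + (1 - Q) * Y * (1 - Q) + codiag Q Y := by
    unfold codiag; noncomm_ring
  have f1 : Q * Y * Q = - (2 • (Q * (X * X) * Q)) := by
    have h1 : Q * ((Y * Q + X * X) + (X * X + Q * Y)) * Q = Q * Y * Q := by rw [e2]
    have h2 : Q * ((Y * Q + X * X) + (X * X + Q * Y)) * Q =
        Q * Y * (Q * Q) + 2 • (Q * (X * X) * Q) + (Q * Q) * Y * Q := by noncomm_ring
    rw [h2, hi] at h1
    have h3 : Q * Y * Q + 2 • (Q * (X * X) * Q) = 0 := by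
      have h4 : (Q * Y * Q + 2 • (Q * (X * X) * Q)) + Q * Y * Q = 0 + Q * Y * Q := by
        rw [h1, zero_add]
      exact add_right_cancel h4
    exact eq_neg_of_add_eq_zero_left h3
  have f2 : (1 - Q) * Y * (1 - Q) = 2 • ((1 - Q) * (X * X) * (1 - Q)) := by
    have hl : (1 - Q) * Q = 0 := by rw [sub_mul, one_mul, hi, sub_self]
    have hr : Q * (1 - Q) = 0 := by rw [mul_sub, mul_one, hi, sub_self]
    have h1 : (1 - Q) * ((Y * Q + X * X) + (X * X + Q * Y)) * (1 - Q) =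
        (1 - Q) * Y * (1 - Q) := by rw [e2]
    have h2 : (1 - Q) * ((Y * Q + X * X) + (X * X + Q * Y)) * (1 - Q) =
        (1 - Q) * Y * (Q * (1 - Q)) + 2 • ((1 - Q) * (X * X) * (1 - Q))
          + ((1 - Q) * Q) * Y * (1 - Q) := by noncomm_ring
    rw [h2, hl, hr] at h1
    rw [← h1]; simp
  rw [hY, hc, f1, f2, smul_sub]
  abel

theorem IsGeodesic.unique {γ δ : ℝ → A} (hγ : IsGeodesic γ) (hδ : IsGeodesic δ)
    (h0 : γ 0 = δ 0) (h1 : deriv γ 0 = deriv δ 0) : γ = δ := by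
  let F : A × A → A × A := fun p =>
    (p.2, 2 • ((1 - p.1) * (p.2 * p.2) * (1 - p.1) - p.1 * (p.2 * p.2) * p.1))
  have hF : ContDiff ℝ 1 F := by
    refine contDiff_snd.prodMk ?_
    have c1 : ContDiff ℝ 1 fun p : A × A => 1 - p.1 := contDiff_const.sub contDiff_fst
    have c2 : ContDiff ℝ 1 fun p : A × A => p.2 * p.2 := contDiff_snd.mul contDiff_snd
    have c3 : ContDiff ℝ 1 fun p : A × A =>
        (1 - p.1) * (p.2 * p.2) * (1 - p.1) - p.1 * (p.2 * p.2) * p.1 :=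
      ((c1.mul c2).mul c1).sub ((contDiff_fst.mul c2).mul contDiff_fst)
    simpa only [two_smul] using! c3.add c3
  have key : ∀ {γ : ℝ → A}, IsGeodesic γ →
      ∀ t, HasDerivAt (fun t => (γ t, deriv γ t)) (F (γ t, deriv γ t)) t := by
    intro γ h t
    have hs : ContDiff ℝ 2 γ := contDiff_infty.1 h.smooth 2
    have hs' : ContDiff ℝ 1 (deriv γ) :=
      ((contDiff_succ_iff_deriv (n := 1) (f := γ) (𝕜 := ℝ)).1 (by simpa using! hs)).2.2
    have a1 := (hs.differentiable (by norm_num) t).hasDerivAt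
    have a2 := (hs'.differentiable (by norm_num) t).hasDerivAt
    rw [h.deriv_deriv t] at a2
    exact a1.prodMk a2
  -- the set of agreement is clopen
  have hcont : ∀ {γ : ℝ → A}, IsGeodesic γ → Continuous (fun t => (γ t, deriv γ t)) :=
    fun h => continuous_iff_continuousAt.2 fun t => (key h t).continuousAt
  have hclosed : IsClosed {t | (γ t, deriv γ t) = (δ t, deriv δ t)} :=
    isClosed_eq (hcont hγ) (hcont hδ)
  have hopen : IsOpen {t | (γ t, deriv γ t) = (δ t, deriv δ t)} := by
    rw [isOpen_iff_mem_nhds]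
    intro t ht
    obtain ⟨K, s, hs, hK⟩ := (hF.contDiffAt (x := (γ t, deriv γ t))).exists_lipschitzOnWith
    have hs2 : s ∈ nhds (δ t, deriv δ t) := by rw [← show _ = _ from ht]; exact hs
    exact ODE_solution_unique_of_eventually (v := fun _ => F) (s := fun _ => s) (K := K)
      (Filter.Eventually.of_forall fun _ => hK)
      (((hcont hγ).continuousAt.eventually_mem hs).mono fun u hu => ⟨key hγ u, hu⟩)
      (((hcont hδ).continuousAt.eventually_mem hs2).mono fun u hu => ⟨key hδ u, hu⟩) ht
  have huniv := IsClopen.eq_univ ⟨hclosed, hopen⟩ ⟨0, by simp [h0, h1]⟩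
  funext t
  have : t ∈ {t | (γ t, deriv γ t) = (δ t, deriv δ t)} := huniv ▸ Set.mem_univ t
  exact congrArg Prod.fst this

end Grassmannian

/-! ### Absolute value, polar decomposition and the algebra `A₀` -/

section Polar

set_option linter.unusedSectionVars false

variable {A : Type*} [CStarAlgebra A]

/-- The absolute value `|a| = (a* a)^{1/2}`. -/
def absVal (a : A) : A := cfc Real.sqrt (star a * a)

theorem isSelfAdjoint_absVal (a : A) : IsSelfAdjoint (absVal a) := cfc_predicate _ _

theorem absVal_mul_absVal (a : A) : absVal a * absVal a = star a * a := by
  let _ : PartialOrder A := CStarAlgebra.spectralOrder A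
  have : StarOrderedRing A := CStarAlgebra.spectralOrderedRing A
  have hsa : IsSelfAdjoint (star a * a) := IsSelfAdjoint.star_mul_self a
  rw [absVal, ← cfc_mul Real.sqrt Real.sqrt (star a * a)]
  conv_rhs => rw [← cfc_id' ℝ (star a * a)]
  refine cfc_congr fun x hx => ?_
  exact Real.mul_self_sqrt (spectrum_nonneg_of_nonneg (star_mul_self_nonneg a) hx)

variable {H : Type*} [NormedAddCommGroup H] [InnerProductSpace ℂ H] [CompleteSpace H]

theorem map_absVal (ρ : A →⋆ₐ[ℂ] (H →L[ℂ] H)) (a : A) : ρ (absVal a) = absVal (ρ a) := by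
  have hsa : IsSelfAdjoint (star a * a) := IsSelfAdjoint.star_mul_self a
  have hc : Continuous ρ := by
    exact AddMonoidHomClass.continuous_of_bound ρ 1 fun x => by
      simpa using NonUnitalStarAlgHom.norm_apply_le ρ x
  have hsa' : IsSelfAdjoint (ρ (star a * a)) := hsa.map ρ
  have h := StarAlgHomClass.map_cfc (R := ℝ) (S := ℂ) ρ Real.sqrt (star a * a)
    (by fun_prop) hc hsa hsa'
  simp only [absVal]
  rw [h, map_mul, map_star]

/-- The closure of the range of an operator. -/
def closedRange (S : H →L[ℂ] H) : Submodule ℂ H :=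
  (LinearMap.range (S : H →ₗ[ℂ] H)).topologicalClosure

instance (S : H →L[ℂ] H) : CompleteSpace (closedRange S) :=
  Submodule.topologicalClosure.completeSpace _

/-- The orthogonal projection `P_S` onto the closure of the range of `S`. -/
def rangeProj (S : H →L[ℂ] H) : H →L[ℂ] H := (closedRange S).starProjection

/-- An operator, with its codomain restricted to the closure of its range. -/
def toClosedRange (S : H →L[ℂ] H) : H →ₗ[ℂ] closedRange S :=
  (S : H →ₗ[ℂ] H).codRestrict (closedRange S)
    fun x => Submodule.le_topologicalClosure _ ⟨x, rfl⟩

/-- The partial isometry `Ω` of the polar decomposition `T = Ω |T|`: it extends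
`|T| ξ ↦ T ξ` by continuity to the closure of the range of `|T|`, and vanishes on the orthogonal
complement. -/
def polarPart (T : H →L[ℂ] H) : H →L[ℂ] H :=
  ((T : H →ₗ[ℂ] H).extendOfNorm (toClosedRange (absVal T))).comp
    (closedRange (absVal T)).orthogonalProjectionOnto

theorem norm_absVal_apply (T : H →L[ℂ] H) (ξ : H) : ‖absVal T ξ‖ = ‖T ξ‖ := by
  have h1 : ∀ S : H →L[ℂ] H, ‖S ξ‖ ^ 2 = RCLike.re (inner ℂ ((star S * S) ξ) ξ) := fun S => by
    rw [ContinuousLinearMap.star_eq_adjoint]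
    exact ContinuousLinearMap.apply_norm_sq_eq_inner_adjoint_left S ξ
  have h2 : ‖absVal T ξ‖ ^ 2 = ‖T ξ‖ ^ 2 := by
    rw [h1, h1, (isSelfAdjoint_absVal T).star_eq, absVal_mul_absVal]
  exact (sq_eq_sq₀ (norm_nonneg _) (norm_nonneg _)).1 h2

theorem denseRange_toClosedRange (S : H →L[ℂ] H) : DenseRange (toClosedRange S) := by
  intro y
  rw [closure_subtype]
  have : (Subtype.val '' Set.range (toClosedRange S)) =
      (LinearMap.range (S : H →ₗ[ℂ] H) : Set H) := by
    ext z
    simp only [Set.mem_image, Set.mem_range, exists_exists_eq_and, SetLike.mem_coe,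
      LinearMap.mem_range]
    rfl
  rw [this]
  exact y.2

theorem polarPart_comp_absVal (T : H →L[ℂ] H) : polarPart T * absVal T = T := by
  ext ξ
  have h1 : absVal T ξ = ((toClosedRange (absVal T) ξ : closedRange (absVal T)) : H) := rfl
  change ((T : H →ₗ[ℂ] H).extendOfNorm (toClosedRange (absVal T)))
    ((closedRange (absVal T)).orthogonalProjectionOnto (absVal T ξ)) = T ξ
  rw [h1, Submodule.orthogonalProjectionOnto_mem_subspace_eq_self]
  refine LinearMap.extendOfNorm_eq (denseRange_toClosedRange _) ⟨1, fun x => ?_⟩ ξ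
  rw [one_mul]
  exact (norm_absVal_apply T x).ge

theorem polarPart_apply_of_mem_orthogonal (T : H →L[ℂ] H) {ξ : H}
    (hξ : ξ ∈ (closedRange (absVal T))ᗮ) : polarPart T ξ = 0 := by
  change ((T : H →ₗ[ℂ] H).extendOfNorm (toClosedRange (absVal T)))
    ((closedRange (absVal T)).orthogonalProjectionOnto ξ) = 0
  rw [Submodule.orthogonalProjectionOnto_eq_zero_iff.2 hξ, map_zero]

/-- The corner `λ = P V (1 - P)` of `V`. -/
def corner (P V : A) : A := P * V * (1 - P)

/-- `A₀ = P_S A P_S` inside the bounded operators, where `S = |λ|` and `A` is identified with its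
image under `ρ`. -/
def A₀ (ρ : A →⋆ₐ[ℂ] (H →L[ℂ] H)) (lam : A) : Submodule ℂ (H →L[ℂ] H) :=
  Submodule.map (LinearMap.mulLeft ℂ (rangeProj (ρ (absVal lam))) ∘ₗ
    LinearMap.mulRight ℂ (rangeProj (ρ (absVal lam))) ∘ₗ
      (ρ.toAlgHom.toLinearMap : A →ₗ[ℂ] (H →L[ℂ] H))) ⊤

theorem mem_A₀ {ρ : A →⋆ₐ[ℂ] (H →L[ℂ] H)} {lam : A} {z : H →L[ℂ] H} :
    z ∈ A₀ ρ lam ↔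
      ∃ a : A, rangeProj (ρ (absVal lam)) * ρ a * rangeProj (ρ (absVal lam)) = z := by
  simp [A₀, mul_assoc]

theorem rangeProj_mul (S : H →L[ℂ] H) : rangeProj S * S = S := by
  ext ξ
  exact Submodule.starProjection_eq_self_iff.2
    (Submodule.le_topologicalClosure _ ⟨ξ, rfl⟩)

theorem mul_rangeProj {S : H →L[ℂ] H} (hS : IsSelfAdjoint S) : S * rangeProj S = S := by
  have h := congrArg star (rangeProj_mul S)
  rw [star_mul, hS.star_eq] at h
  have h2 : star (rangeProj S) = rangeProj S :=
    (isStarProjection_starProjection (U := closedRange S)).isSelfAdjoint.star_eq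
  rwa [h2] at h

theorem mul_add_mul_mem_A₀ (ρ : A →⋆ₐ[ℂ] (H →L[ℂ] H)) (lam : A) (z : H →L[ℂ] H)
    (hz : z ∈ A₀ ρ lam) :
    (LinearMap.mulLeft ℂ (ρ (absVal lam)) + LinearMap.mulRight ℂ (ρ (absVal lam))) z
      ∈ A₀ ρ lam := by
  obtain ⟨a, rfl⟩ := mem_A₀.1 hz
  refine mem_A₀.2 ⟨absVal lam * a + a * absVal lam, ?_⟩
  have h1 := rangeProj_mul (ρ (absVal lam))
  have h2 := mul_rangeProj ((isSelfAdjoint_absVal lam).map ρ)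
  simp only [LinearMap.add_apply, LinearMap.mulLeft_apply, LinearMap.mulRight_apply, map_add,
    map_mul]
  generalize ρ (absVal lam) = S at *
  generalize rangeProj S = R at *
  calc R * (S * ρ a + ρ a * S) * R = (R * S) * ρ a * R + R * ρ a * (S * R) := by noncomm_ring
    _ = (S * R) * ρ a * R + R * ρ a * (R * S) := by rw [h1, h2]
    _ = _ := by noncomm_ring

/-- The operator `L_{|λ|} + R_{|λ|}` of left plus right multiplication by `|λ|`, acting on `A₀`. -/
def leftAddRight (ρ : A →⋆ₐ[ℂ] (H →L[ℂ] H)) (lam : A) : Module.End ℂ (A₀ ρ lam) :=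
  (LinearMap.mulLeft ℂ (ρ (absVal lam)) + LinearMap.mulRight ℂ (ρ (absVal lam))).restrict
    (mul_add_mul_mem_A₀ ρ lam)

end Polar

end

end CStarGrassmannian

open CStarGrassmannian

/-!
Put `ε = 2P - 1`, a symmetry anticommuting with the generators `w = [W, P]` of tangent vectors.
Then `Exp_P(W) = (1 + e^{2w} ε) / 2` (`grExp_eq`), so the differential of the exponential map at
`W` is, up to the factor `ε`, the derivative `dexp` of the exponential of the algebra at `2w`,
restricted to skew-adjoint elements anticommuting with `ε` (`fderiv_grExp`). No integral formula
for `dexp` is needed: since `exp (2a) = (exp a)²`, the derivative at `2a` is the derivative at `a`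
followed by half the Sylvester operator `y ↦ u y + y u` of `u = e^a` (`dexp_add_self`).

Write `v = [V, P] = i h` with `h` self-adjoint of norm one. For `|t| < π / 2` the spectrum of `u =
e^{tv}` lies in an open disc `|z - c| < c`, so its Sylvester operator is a small perturbation of
`2c` and is invertible; halving down to a neighbourhood of `0` makes `dexp` invertible at `tv` for
all `|t| < π` (`isUnit_dexp`). Compatibility of `dexp` with the adjoint, with conjugation by `ε`
and with inversion turns this into bijectivity between the tangent spaces (`dExp_surjective`),
hence there are no conjugate points before `π / 2`.

At time `π / 2` one more Sylvester operator enters, that of `u = e^{π v / 2}`, whose spectrum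
touches `±i`. As `ε h ε = -h`, the number `1` is in the spectrum of `h`, and compressing to
approximate eigenvectors shows that the tangent vector `h` is not in the range of the differential
(`sylvester_exp_mul_ne`, `isEpiconjugate_pi_div_two`). So the point is always epiconjugate.

For the kernel, `u y = -y u` makes `r = u + u*` anticommute with `y`. As `r` is positive, `r y =
0`, and this forces `v² y = -y` and `v y = -y v` (`of_sylvester_exp_eq_zero`). Directions of this
kind are tangent to the conjugation orbit of `v`, where `dexp` is explicit
(`smul_dexp_eq_commutator`); hence the kernel of the differential consists of the generators
satisfying these two equations (`dExp_pi_div_two_eq_zero_iff`). In terms of corners `λ` of `V` and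
`ξ` of `X`, they say that `z = λ* ξ` is skew-adjoint, fixed by `|λ|`, and that `ξ = λ z`
(`gen_condition_iff`).

Finally `‖λ‖ = ‖V‖ = 1`, so `1` is in the spectrum of `|λ|`, and compressing to approximate
eigenvectors of `|λ|` shows that `L_{|λ|} + R_{|λ|} - 2` misses `P_{|λ|}` (`mul_sub_two_mul_ne`).
-/

namespace CStarGrassmannian

open scoped Topology

/-! ### The derivative of the exponential -/

section ExpDerivative

variable {A : Type*} [CStarAlgebra A]

/-- The Fréchet derivative, over `ℝ`, of the exponential of a C*-algebra at `a`. -/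
noncomputable def dexp (a : A) : A →L[ℝ] A := fderiv ℝ (NormedSpace.exp : A → A) a

theorem contDiff_exp : ContDiff ℝ 1 (NormedSpace.exp : A → A) :=
  contDiff_iff_contDiffAt.2 fun x => (NormedSpace.exp_analytic (𝕂 := ℝ) x).contDiffAt

theorem hasFDerivAt_exp (a : A) : HasFDerivAt (NormedSpace.exp : A → A) (dexp a) a :=
  (contDiff_exp.differentiable (by simp) a).hasFDerivAt

theorem exp_add_self (a : A) :
    NormedSpace.exp (a + a) = NormedSpace.exp a * NormedSpace.exp a := by
  let +nondep : NormedAlgebra ℚ A := .restrictScalars ℚ ℂ A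
  exact NormedSpace.exp_add_of_commute (Commute.refl a)

theorem exp_neg_mul_exp (a : A) : NormedSpace.exp (-a) * NormedSpace.exp a = 1 := by
  let +nondep : NormedAlgebra ℚ A := .restrictScalars ℚ ℂ A
  rw [← NormedSpace.exp_add_of_commute (Commute.refl a).neg_left]
  simp

theorem exp_mul_exp_neg (a : A) : NormedSpace.exp a * NormedSpace.exp (-a) = 1 := by
  simpa using exp_neg_mul_exp (-a)

theorem exp_conj_of_sq_eq_one {ε : A} (hε : ε * ε = 1) (a : A) :
    NormedSpace.exp (ε * a * ε) = ε * NormedSpace.exp a * ε := by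
  let +nondep : NormedAlgebra ℚ A := .restrictScalars ℚ ℂ A
  exact NormedSpace.exp_units_conj (⟨ε, ε, hε, hε⟩ : Aˣ) a

theorem exp_conj_exp (k a : A) :
    NormedSpace.exp (NormedSpace.exp k * a * NormedSpace.exp (-k)) =
      NormedSpace.exp k * NormedSpace.exp a * NormedSpace.exp (-k) := by
  let +nondep : NormedAlgebra ℚ A := .restrictScalars ℚ ℂ A
  exact NormedSpace.exp_units_conj
    (⟨NormedSpace.exp k, NormedSpace.exp (-k), exp_mul_exp_neg k, exp_neg_mul_exp k⟩ : Aˣ) a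

/-- Halving: since `exp (2a) = (exp a)²`, the derivative at `2a` is that at `a` followed by
`y ↦ e^a y + y e^a`. -/
theorem dexp_add_self (a x : A) :
    dexp (a + a) (x + x) = NormedSpace.exp a * dexp a x + dexp a x * NormedSpace.exp a := by
  have h1 : HasFDerivAt (fun b : A => NormedSpace.exp (b + b))
      ((dexp (a + a)).comp (ContinuousLinearMap.id ℝ A + ContinuousLinearMap.id ℝ A)) a :=
    HasFDerivAt.comp a (hasFDerivAt_exp (a + a)) ((hasFDerivAt_id a).add (hasFDerivAt_id a))
  have h2 := HasFDerivAt.mul' (𝕜 := ℝ) (hasFDerivAt_exp a) (hasFDerivAt_exp a)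
  have h3 : (fun b : A => NormedSpace.exp (b + b)) =
      (NormedSpace.exp : A → A) * NormedSpace.exp := funext exp_add_self
  rw [h3] at h1
  simpa using congrArg (fun L : A →L[ℝ] A => L x) (h1.unique h2)

theorem dexp_star (a x : A) : dexp (star a) (star x) = star (dexp a x) := by
  have h1 := (hasFDerivAt_exp a).star
  have h2 := HasFDerivAt.comp a (hasFDerivAt_exp (star a)) (hasFDerivAt_id (𝕜 := ℝ) a).star
  have h3 : (NormedSpace.exp : A → A) ∘ star =
      fun b : A => star (NormedSpace.exp b) :=
    funext fun b => (NormedSpace.star_exp b).symm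
  rw [h3] at h2
  simpa using congrArg (fun L : A →L[ℝ] A => L x) (h2.unique h1)

theorem dexp_conj {ε : A} (hε : ε * ε = 1) (a x : A) :
    dexp (ε * a * ε) (ε * x * ε) = ε * dexp a x * ε := by
  have hl : ∀ b : A, HasFDerivAt (fun b : A => ε * b * ε)
      (((ContinuousLinearMap.mul ℝ A) ε).comp ((ContinuousLinearMap.mul ℝ A).flip ε)) b :=
    fun b => by
      convert! (((ContinuousLinearMap.mul ℝ A) ε).comp
        ((ContinuousLinearMap.mul ℝ A).flip ε)).hasFDerivAt using 1
      ext c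
      simp [mul_assoc]
  have h1 := HasFDerivAt.comp a (hl _) (hasFDerivAt_exp a)
  have h2 := HasFDerivAt.comp a (hasFDerivAt_exp _) (hl a)
  have h3 : (NormedSpace.exp : A → A) ∘ (fun b : A => ε * b * ε) =
      (fun b : A => ε * b * ε) ∘ NormedSpace.exp := funext (exp_conj_of_sq_eq_one hε)
  rw [h3] at h2
  simpa [mul_assoc] using congrArg (fun L : A →L[ℝ] A => L x) (h2.unique h1)

theorem dexp_neg (a x : A) :
    dexp (-a) x = NormedSpace.exp (-a) * dexp a x * NormedSpace.exp (-a) := by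
  have h1 := HasFDerivAt.comp a (hasFDerivAt_exp (-a)) (hasFDerivAt_id (𝕜 := ℝ) a).neg
  have h2 := HasFDerivAt.mul' (𝕜 := ℝ) h1 (hasFDerivAt_exp a)
  have h3 : ((NormedSpace.exp : A → A) ∘ Neg.neg) * NormedSpace.exp = fun _ => (1 : A) :=
    funext exp_neg_mul_exp
  rw [h3] at h2
  have h4 := congrArg (fun L : A →L[ℝ] A => L x) (h2.unique (hasFDerivAt_const _ _))
  have h5 : NormedSpace.exp (-a) * dexp a x = dexp (-a) x * NormedSpace.exp a := by
    simpa [← sub_eq_add_neg, sub_eq_zero] using h4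
  rw [h5, mul_assoc, exp_mul_exp_neg, mul_one]

/-- The derivative of the exponential along a conjugation orbit. -/
theorem dexp_commutator (k a : A) :
    dexp a (k * a - a * k) = k * NormedSpace.exp a - NormedSpace.exp a * k := by
  have h1 := hasDerivAt_conj a k 0
  have h2 := hasDerivAt_conj (NormedSpace.exp a) k 0
  have h3 : (fun t : ℝ => NormedSpace.exp (t • k) * NormedSpace.exp a *
      NormedSpace.exp (t • (-k))) = NormedSpace.exp ∘
      fun t : ℝ => NormedSpace.exp (t • k) * a * NormedSpace.exp (t • (-k)) := by
    funext t
    simp only [Function.comp, smul_neg, exp_conj_exp]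
  rw [h3] at h2
  have h4 := HasFDerivAt.comp_hasDerivAt_of_eq (0 : ℝ) (hasFDerivAt_exp a) h1 (by simp)
  simpa using h4.unique h2

/-- Near `0` the derivative of the exponential is invertible. -/
theorem eventually_isUnit_dexp : ∀ᶠ a in 𝓝 (0 : A), IsUnit (dexp a) := by
  have h0 : dexp (0 : A) = 1 := (hasFDerivAt_exp (0 : A)).unique hasFDerivAt_exp_zero
  have hc : ContinuousAt (dexp : A → A →L[ℝ] A) 0 :=
    (contDiff_exp.continuous_fderiv (by simp)).continuousAt
  exact hc.eventually (by rw [h0]; exact Units.isOpen.mem_nhds isUnit_one)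

theorem isUnit_real_smul {F : A →L[ℝ] A} (hF : IsUnit F) {c : ℝ} (hc : c ≠ 0) :
    IsUnit (c • F) := by
  obtain ⟨u, rfl⟩ := hF
  refine ⟨⟨c • u, c⁻¹ • ↑u⁻¹, ?_, ?_⟩, rfl⟩
  · ext x
    have h : (u : A →L[ℝ] A) ((↑u⁻¹ : A →L[ℝ] A) x) = x :=
      congrArg (fun F : A →L[ℝ] A => F x) u.mul_inv
    simp [hc, h]
  · ext x
    have h : (↑u⁻¹ : A →L[ℝ] A) ((u : A →L[ℝ] A) x) = x :=
      congrArg (fun F : A →L[ℝ] A => F x) u.inv_mul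
    simp [hc, h]

/-- The Sylvester operator `y ↦ u y + y u`. -/
noncomputable def sylvester (u : A) : A →L[ℝ] A :=
  ContinuousLinearMap.mul ℝ A u + (ContinuousLinearMap.mul ℝ A).flip u

@[simp]
theorem sylvester_apply (u y : A) : sylvester u y = u * y + y * u := rfl

/-- If `u` is within distance less than `c` of the scalar `c`, then its Sylvester operator is
within distance less than `2c` of `2c`. -/
theorem isUnit_sylvester {u : A} {c : ℝ} (h : ‖u - algebraMap ℝ A c‖ < c) :
    IsUnit (sylvester u) := by
  have hc : 0 < c := (norm_nonneg _).trans_lt h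
  have h1 : sylvester u = (2 * c) • (1 - (-(2 * c)⁻¹) • sylvester (u - algebraMap ℝ A c)) := by
    ext y
    have : (2 * c) * (2 * c)⁻¹ = 1 := mul_inv_cancel₀ (by positivity)
    simp only [_root_.smul_apply, _root_.sub_apply, sylvester_apply,
      smul_sub, smul_smul, mul_neg, this, sub_mul, mul_sub, one_apply_eq_self]
    rw [← Algebra.commutes c y, ← Algebra.smul_def]
    module
  have h2 : ‖sylvester (u - algebraMap ℝ A c)‖ ≤ 2 * ‖u - algebraMap ℝ A c‖ := by
    refine ContinuousLinearMap.opNorm_le_bound _ (by positivity) fun y => ?_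
    calc _ ≤ ‖(u - algebraMap ℝ A c) * y‖ + ‖y * (u - algebraMap ℝ A c)‖ := norm_add_le _ _
      _ ≤ ‖u - algebraMap ℝ A c‖ * ‖y‖ + ‖y‖ * ‖u - algebraMap ℝ A c‖ :=
        add_le_add (norm_mul_le _ _) (norm_mul_le _ _)
      _ = _ := by ring
  rw [h1]
  refine isUnit_real_smul (isUnit_one_sub_of_norm_lt_one ?_) (by positivity)
  rw [norm_smul, norm_neg, norm_inv, Real.norm_of_nonneg (by positivity),
    inv_mul_lt_iff₀ (by positivity)]
  linarith

theorem dexp_add_self_eq (a : A) : dexp (a + a) = (2⁻¹ : ℝ) • (sylvester (NormedSpace.exp a) *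
    dexp a) := by
  ext x
  have h := dexp_add_self a x
  rw [map_add, ← two_smul ℝ] at h
  exact (eq_inv_smul_iff₀ (by norm_num : (2 : ℝ) ≠ 0)).2 h

end ExpDerivative

/-! ### Functional calculus of a self-adjoint contraction -/

section Spectral

open Filter

variable {A : Type*} [CStarAlgebra A]

theorem abs_le_one_of_mem_spectrum [Nontrivial A] {h : A} (hn : ‖h‖ ≤ 1) {s : ℝ}
    (hs : s ∈ spectrum ℝ h) : |s| ≤ 1 :=
  (spectrum.norm_le_norm_of_mem hs).trans hn

theorem exists_real_of_mem_spectrum [Nontrivial A] {h : A} (hh : IsSelfAdjoint h)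
    (hn : ‖h‖ ≤ 1) {z : ℂ} (hz : z ∈ spectrum ℂ h) : ∃ s : ℝ, z = s ∧ |s| ≤ 1 := by
  refine ⟨z.re, hh.mem_spectrum_eq_re hz, ?_⟩
  exact (Complex.abs_re_le_norm z).trans ((spectrum.norm_le_norm_of_mem hz).trans hn)

theorem exp_smul_I_smul {h : A} (hh : IsSelfAdjoint h) (t : ℝ) :
    NormedSpace.exp (t • Complex.I • h) = cfc (fun z : ℂ => Complex.exp (t * Complex.I * z)) h := by
  have h1 : t • Complex.I • h = ((t : ℂ) * Complex.I) • h := by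
    rw [mul_smul, Complex.coe_smul]
  have h2 : IsStarNormal (((t : ℂ) * Complex.I) • h) := by
    have := hh.isStarNormal
    infer_instance
  have h3 : IsStarNormal h := hh.isStarNormal
  rw [h1, ← CFC.complex_exp_eq_normedSpace_exp h2,
    cfc_comp_const_mul ((t : ℂ) * Complex.I) Complex.exp h]

/-- For `|t| < π / 2` the spectrum of `e^{i t h}` lies in the open disc with centre `c` and
radius `c`, where `c = 1 / cos t`. -/
theorem isUnit_sylvester_exp [Nontrivial A] {h : A} (hh : IsSelfAdjoint h) (hn : ‖h‖ ≤ 1) {t : ℝ}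
    (ht : |t| < Real.pi / 2) : IsUnit (sylvester (NormedSpace.exp (t • Complex.I • h))) := by
  have hcos : 0 < Real.cos t := Real.cos_pos_of_mem_Ioo (abs_lt.1 ht)
  have hN : IsStarNormal h := hh.isStarNormal
  apply isUnit_sylvester (c := (Real.cos t)⁻¹)
  have h1 : algebraMap ℝ A (Real.cos t)⁻¹ = cfc (fun _ : ℂ => ((Real.cos t)⁻¹ : ℂ)) h := by
    rw [cfc_const _ h, IsScalarTower.algebraMap_apply ℝ ℂ A]
    simp
  rw [exp_smul_I_smul hh, h1, ← cfc_sub _ _ h]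
  refine norm_cfc_lt (by positivity) fun z hz => ?_
  obtain ⟨s, rfl, hs⟩ := exists_real_of_mem_spectrum hh hn hz
  have hcos2 : Real.cos t ≤ Real.cos (t * s) := by
    rw [← Real.cos_abs t, ← Real.cos_abs (t * s), abs_mul]
    refine Real.cos_le_cos_of_nonneg_of_le_pi (by positivity) (by linarith [Real.pi_pos]) ?_
    exact mul_le_of_le_one_right (abs_nonneg _) hs
  have h2 : Complex.exp (t * Complex.I * s) - ((Real.cos t)⁻¹ : ℂ) =
      ⟨Real.cos (t * s) - (Real.cos t)⁻¹, Real.sin (t * s)⟩ := by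
    rw [show (t : ℂ) * Complex.I * s = ((t * s : ℝ) : ℂ) * Complex.I by push_cast; ring,
      Complex.exp_ofReal_mul_I, ← Complex.ofReal_inv]
    apply Complex.ext <;>
      simp [-Complex.ofReal_cos, -Complex.ofReal_sin, -Complex.ofReal_inv, -Complex.ofReal_mul]
  rw [h2]
  refine lt_of_pow_lt_pow_left₀ 2 (by positivity) ?_
  rw [Complex.sq_norm, Complex.normSq_mk]
  have h3 := Real.sin_sq_add_cos_sq (t * s)
  have h4 : 1 ≤ Real.cos (t * s) * (Real.cos t)⁻¹ := by
    rw [← div_eq_mul_inv, one_le_div hcos]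
    exact hcos2
  nlinarith

/-- Along a skew-adjoint contraction `i h` the exponential is a local diffeomorphism up to
time `π`, by halving. -/
theorem isUnit_dexp [Nontrivial A] {h : A} (hh : IsSelfAdjoint h) (hn : ‖h‖ ≤ 1) {t : ℝ}
    (ht : |t| < Real.pi) : IsUnit (dexp (t • Complex.I • h)) := by
  have step : ∀ s : ℝ, |s| < Real.pi / 2 → IsUnit (dexp (s • Complex.I • h)) →
      IsUnit (dexp ((2 * s) • Complex.I • h)) := fun s hs hu => by
    rw [two_mul, add_smul, dexp_add_self_eq]
    exact isUnit_real_smul ((isUnit_sylvester_exp hh hn hs).mul hu) (by norm_num)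
  have hlim : Tendsto (fun n : ℕ => (t / 2 ^ n) • Complex.I • h) atTop (𝓝 0) := by
    have h1 : Tendsto (fun n : ℕ => t / 2 ^ n) atTop (𝓝 0) :=
      tendsto_const_nhds.div_atTop (tendsto_pow_atTop_atTop_of_one_lt (by norm_num))
    simpa using h1.smul_const (Complex.I • h)
  obtain ⟨n, hn'⟩ := (hlim.eventually eventually_isUnit_dexp).exists
  clear hlim
  -- double `n` times, from `t / 2 ^ n` back to `t`; every intermediate time is below `π / 2`
  induction n with
  | zero => simpa using hn'
  | succ n ih =>
    refine ih ?_
    have h1 : t / 2 ^ n = 2 * (t / 2 ^ (n + 1)) := by field_simp; ring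
    rw [h1]
    refine step _ ?_ hn'
    rw [abs_div, abs_of_pos (by positivity : (0 : ℝ) < 2 ^ (n + 1)), div_lt_iff₀ (by positivity)]
    have h2 : (1 : ℝ) ≤ 2 ^ n := one_le_pow₀ (by norm_num)
    rw [pow_succ]
    nlinarith [Real.pi_pos]

/-- Approximate eigenvectors inside the algebra: if `1` is in the spectrum of `h`, then bump
functions of `h` concentrated near `1` are elements of norm one on which every function `f` of `h`
acts, asymptotically, as the scalar `f 1`. -/
theorem exists_approx_eigenvectors {h : A} (hh : IsSelfAdjoint h)
    (h1 : (1 : ℝ) ∈ spectrum ℝ h) :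
    ∃ g : ℕ → A, (∀ n, ‖g n‖ = 1) ∧ (∀ n, ‖g n * g n‖ = 1) ∧
      (∀ f : ℂ → ℂ, ∀ n, g n * cfc f h = cfc f h * g n) ∧
      ∀ f : ℂ → ℂ, Continuous f →
        Tendsto (fun n => cfc f h * g n - f 1 • g n) atTop (𝓝 0) := by
  have hN : IsStarNormal h := hh.isStarNormal
  have h1' : (1 : ℂ) ∈ spectrum ℂ h := by
    have := (hh.spectrumRestricts).algebraMap_image
    rw [← this]
    exact ⟨1, h1, by simp⟩
  let b : ℕ → ℂ → ℂ := fun n z => ((max 0 (1 - (n + 1) * ‖z - 1‖) : ℝ) : ℂ)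
  have hb : ∀ n, Continuous (b n) := fun n => by fun_prop
  have hb1 : ∀ n z, ‖b n z‖ ≤ 1 := fun n z => by
    rw [Complex.norm_real, Real.norm_of_nonneg (le_max_left _ _)]
    refine max_le zero_le_one ?_
    have : 0 ≤ ((n : ℝ) + 1) * ‖z - 1‖ := by positivity
    linarith
  have hsa : ∀ n, star (cfc (b n) h) = cfc (b n) h := fun n => by
    rw [← cfc_star]
    simp [b]
  have hnorm : ∀ n, ‖cfc (b n) h‖ = 1 := fun n => by
    refine le_antisymm (norm_cfc_le zero_le_one fun z _ => hb1 n z) ?_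
    have := norm_apply_le_norm_cfc (b n) h h1' (hb n).continuousOn
    simpa [b] using this
  refine ⟨fun n => cfc (b n) h, hnorm, fun n => ?_, fun f n => cfc_commute_cfc _ _ _,
    fun f hf => ?_⟩
  · have := CStarRing.norm_star_mul_self (x := cfc (b n) h)
    rw [hsa, hnorm] at this
    simpa using this
  · rw [Metric.tendsto_atTop]
    intro δ hδ
    obtain ⟨η, hη, hf1⟩ := Metric.continuous_iff.1 hf 1 (δ / 2) (by positivity)
    obtain ⟨N, hN'⟩ := exists_nat_one_div_lt hη
    refine ⟨N, fun n hn => ?_⟩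
    rw [dist_zero_right, ← cfc_const_mul (f 1) (b n) h (hb n).continuousOn,
      ← cfc_mul f (b n) h hf.continuousOn (hb n).continuousOn,
      ← cfc_sub _ _ h (by fun_prop) (by fun_prop)]
    refine (norm_cfc_le (c := δ / 2) (by positivity) fun z _ => ?_).trans_lt (by linarith)
    rw [← sub_mul, norm_mul]
    by_cases hz : ‖z - 1‖ < η
    · have h3 := hf1 z (by rwa [dist_eq_norm])
      rw [dist_eq_norm] at h3
      calc _ ≤ δ / 2 * 1 := mul_le_mul h3.le (hb1 n z) (norm_nonneg _) (by positivity)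
        _ = _ := mul_one _
    · have h3 : b n z = 0 := by
        have h4 : 1 ≤ ((n : ℝ) + 1) * ‖z - 1‖ := by
          have h5 : 1 / ((n : ℝ) + 1) ≤ 1 / ((N : ℝ) + 1) := by
            have : (N : ℝ) ≤ n := by exact_mod_cast hn
            gcongr
          have h6 : 1 / ((n : ℝ) + 1) ≤ ‖z - 1‖ := h5.trans (hN'.le.trans (not_lt.1 hz))
          rwa [div_le_iff₀' (by positivity)] at h6
        simp only [b]
        rw [max_eq_left (by linarith), Complex.ofReal_zero]
      rw [h3, norm_zero, mul_zero]
      positivity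

/-- If `|f| ≤ |g|` on the spectrum, then `y* f(h)² y ≤ y* g(h)² y`, so `f(h)` annihilates whatever
`g(h)` does. -/
theorem cfc_mul_eq_zero_of_abs_le {h y : A} {f g : ℝ → ℝ}
    (hf : Continuous f) (hg : Continuous g) (hfg : ∀ s ∈ spectrum ℝ h, |f s| ≤ |g s|)
    (h0 : cfc g h * y = 0) : cfc f h * y = 0 := by
  let _ : PartialOrder A := CStarAlgebra.spectralOrder A
  have : StarOrderedRing A := CStarAlgebra.spectralOrderedRing A
  have key : ∀ k : ℝ → ℝ, Continuous k →
      star (cfc k h * y) * (cfc k h * y) = star y * cfc (fun s => k s * k s) h * y := fun k hk => by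
    rw [cfc_mul k k h, star_mul, (cfc_predicate k h : IsSelfAdjoint (cfc k h)).star_eq]
    simp only [mul_assoc]
  have h1 : cfc (fun s => f s * f s) h ≤ cfc (fun s => g s * g s) h :=
    cfc_mono fun s hs => by
      have := mul_self_le_mul_self (abs_nonneg _) (hfg s hs)
      simpa using this
  have h2 := star_left_conjugate_le_conjugate h1 y
  rw [← key f hf, ← key g hg, h0, mul_zero] at h2
  exact CStarRing.star_mul_self_eq_zero_iff _ |>.1 (le_antisymm h2 (star_mul_self_nonneg _))

/-- Euler's formula on an element where `v² = -1`. -/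
theorem exp_smul_mul_of_sq {v x : A} (hx : v * (v * x) = -x) (θ : ℝ) :
    NormedSpace.exp (θ • v) * x = Real.cos θ • x + Real.sin θ • (v * x) := by
  have hd : ∀ s : ℝ, HasDerivAt (fun s : ℝ => NormedSpace.exp (s • (-v)) *
      (Real.cos s • x + Real.sin s • (v * x))) 0 s := fun s => by
    have h1 := (hasDerivAt_exp_smul_const (-v) s).mul
      (((Real.hasDerivAt_cos s).smul_const x).add ((Real.hasDerivAt_sin s).smul_const (v * x)))
    convert! h1 using 1
    change 0 = NormedSpace.exp (s • -v) * -v * (Real.cos s • x + Real.sin s • (v * x)) + _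
    have h2 : v * (Real.cos s • x + Real.sin s • (v * x)) =
        Real.cos s • (v * x) - Real.sin s • x := by
      rw [mul_add, mul_smul_comm, mul_smul_comm, hx, smul_neg, sub_eq_add_neg]
    rw [mul_assoc, ← mul_add, neg_mul, h2, neg_smul, neg_sub,
      show Real.sin s • x - Real.cos s • (v * x) +
        (-(Real.sin s • x) + Real.cos s • (v * x)) = 0 by abel, mul_zero]
  have hc := is_const_of_deriv_eq_zero (fun s => (hd s).differentiableAt)
    (fun s => (hd s).deriv) θ 0
  simp only [zero_smul, NormedSpace.exp_zero, Real.cos_zero, Real.sin_zero, one_smul, add_zero,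
    one_mul] at hc
  conv_lhs => rw [← hc, smul_neg, ← mul_assoc, exp_mul_exp_neg, one_mul]

theorem mul_exp_smul_of_sq {v x : A} (hv : star v = -v) (hx : v * (v * star x) = -star x)
    (θ : ℝ) : x * NormedSpace.exp (θ • v) = Real.cos θ • x + Real.sin θ • (x * v) := by
  have h1 := congrArg star (exp_smul_mul_of_sq hx (-θ))
  simpa [NormedSpace.star_exp, hv] using h1

theorem one_sub_sq_le_two_cos {s : ℝ} (hs : |s| ≤ 1) :
    |1 - s * s| ≤ |2 * Real.cos (Real.pi / 2 * s)| := by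
  have h1 : 1 - 2 / Real.pi * (Real.pi / 2 * |s|) ≤ Real.cos (Real.pi / 2 * |s|) :=
    Real.one_sub_mul_le_cos (by positivity)
      (mul_le_of_le_one_right (by positivity) hs)
  have h2 : 2 / Real.pi * (Real.pi / 2 * |s|) = |s| := by field_simp
  have h3 : Real.cos (Real.pi / 2 * |s|) = Real.cos (Real.pi / 2 * s) := by
    rw [← Real.cos_abs (Real.pi / 2 * s), abs_mul, abs_of_pos (by positivity : 0 < Real.pi / 2)]
  rw [h2, h3] at h1
  have h4 : s * s = |s| * |s| := (abs_mul_abs_self s).symm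
  have h5 := abs_nonneg s
  rw [h4, abs_of_nonneg (a := 1 - |s| * |s|) (by nlinarith)]
  refine le_trans ?_ (le_abs_self _)
  nlinarith [mul_nonneg (sub_nonneg.2 hs) (sub_nonneg.2 hs)]

/-- The kernel of the Sylvester operator of `e^{π v / 2}`: it consists of elements on which
`v² = -1` and which anticommute with `v = i h`. -/
theorem of_sylvester_exp_eq_zero [Nontrivial A] {h y : A} (hh : IsSelfAdjoint h) (hn : ‖h‖ ≤ 1)
    (hy : sylvester (NormedSpace.exp ((Real.pi / 2) • Complex.I • h)) y = 0) :
    (Complex.I • h) * ((Complex.I • h) * y) = -y ∧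
      (Complex.I • h) * y = -(y * (Complex.I • h)) := by
  set v : A := Complex.I • h with hv
  have hN : IsStarNormal h := hh.isStarNormal
  have hvs : star v = -v := by simp [hv, hh.star_eq]
  set u := NormedSpace.exp ((Real.pi / 2) • v) with hu
  set w := NormedSpace.exp ((-(Real.pi / 2)) • v) with hw
  have huw : u * w = 1 := by rw [hw, neg_smul, exp_mul_exp_neg]
  have hwu : w * u = 1 := by rw [hw, neg_smul, exp_neg_mul_exp]
  rw [sylvester_apply] at hy
  have huy : u * y = -(y * u) := eq_neg_of_add_eq_zero_left hy
  have hwy : w * y = -(y * w) := by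
    calc w * y = w * (y * u) * w := by rw [mul_assoc, mul_assoc, huw, mul_one]
      _ = -(w * (u * y) * w) := by rw [huy]; noncomm_ring
      _ = _ := by rw [← mul_assoc w, hwu, one_mul]
  -- `r = u + u*` is positive and anticommutes with `y`; its square commutes with `y`, hence so
  -- does `r` itself, and therefore `r y = 0`
  let c : ℝ → ℝ := fun s => 2 * Real.cos (Real.pi / 2 * s)
  have hc : Continuous c := by fun_prop
  have hr : u + w = cfc c h := by
    rw [hu, hw, exp_smul_I_smul hh, exp_smul_I_smul hh, ← cfc_add h _ _, cfc_real_eq_complex c hh]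
    refine cfc_congr fun z hz => ?_
    obtain ⟨s, rfl, -⟩ := exists_real_of_mem_spectrum hh hn hz
    simp only [c, Complex.ofReal_re, Complex.ofReal_mul, Complex.ofReal_cos, Complex.ofReal_ofNat,
      Complex.two_cos]
    push_cast
    ring_nf
  have hry : cfc c h * y = -(y * cfc c h) := by
    rw [← hr, add_mul, mul_add, huy, hwy, neg_add]
  have hcomm : Commute (cfc c h) y := by
    have h1 : cfc Real.sqrt (cfc (fun s => c s * c s) h) = cfc c h := by
      rw [← cfc_comp' Real.sqrt (fun s => c s * c s) h]
      refine cfc_congr fun s hs => ?_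
      have hs' := abs_le.1 (abs_le_one_of_mem_spectrum hn hs)
      refine Real.sqrt_mul_self (mul_nonneg zero_le_two (Real.cos_nonneg_of_mem_Icc ?_))
      have hp := Real.pi_pos
      constructor <;> nlinarith
    rw [← h1]
    refine Commute.cfc_real ?_ _
    rw [cfc_mul c c h]
    calc cfc c h * cfc c h * y = -(cfc c h * y * cfc c h) := by
          rw [mul_assoc (cfc c h) (cfc c h), hry, mul_neg, ← mul_assoc, hry]
      _ = y * (cfc c h * cfc c h) := by rw [hry, neg_mul, neg_neg, mul_assoc]
  have hry0 : cfc c h * y = 0 := by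
    have h1 : cfc c h * y = -(cfc c h * y) := by
      conv_rhs => rw [hcomm.eq]
      exact hry
    have h2 : (2 : ℝ) • (cfc c h * y) = 0 := by
      rw [two_smul, ← eq_neg_iff_add_eq_zero]
      exact h1
    exact (smul_eq_zero.1 h2).resolve_left two_ne_zero
  have hyr0 : cfc c h * star y = 0 := by
    have h1 : y * cfc c h = 0 := by rw [← hcomm.eq, hry0]
    have h2 := congrArg star h1
    rwa [star_mul, star_zero, (cfc_predicate c h : IsSelfAdjoint (cfc c h)).star_eq] at h2
  -- `r` is a function of `h` vanishing only at `±1`, so `h² = 1` on its kernel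
  have hsq : ∀ x : A, cfc c h * x = 0 → v * (v * x) = -x := fun x hx => by
    have h1 := cfc_mul_eq_zero_of_abs_le (f := fun s => 1 - s * s) (by fun_prop) hc
      (fun s hs => one_sub_sq_le_two_cos (abs_le_one_of_mem_spectrum hn hs)) hx
    have h2 : cfc (fun s : ℝ => 1 - s * s) h = 1 - h * h := by
      rw [cfc_sub (fun _ => (1 : ℝ)) (fun s => s * s) h, cfc_const_one ℝ h,
        cfc_mul (fun s : ℝ => s) (fun s => s) h, cfc_id' ℝ h]
    rw [h2, sub_mul, one_mul, sub_eq_zero] at h1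
    simp only [hv, smul_mul_assoc, mul_smul_comm, smul_smul, Complex.I_mul_I]
    rw [← mul_assoc, ← h1]
    simp
  have h1 := hsq y hry0
  have h2 := hsq (star y) hyr0
  refine ⟨h1, ?_⟩
  have e1 : u * y = v * y := by simpa using exp_smul_mul_of_sq h1 (Real.pi / 2)
  have e2 : y * u = y * v := by simpa using mul_exp_smul_of_sq hvs h2 (Real.pi / 2)
  rw [← e1, ← e2, huy]

end Spectral

/-! ### The differential of the exponential map of the Grassmannian -/

section Differential

open Filter

variable {A : Type*} [CStarAlgebra A]

/-- The self-adjoint symmetry `2P - 1` attached to a projection `P`. -/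
def symmetry (P : A) : A := 2 • P - 1

theorem symmetry_mul_self {P : A} (hP : IsStarProjection P) : symmetry P * symmetry P = 1 := by
  have h1 : P * P = P := hP.isIdempotentElem
  calc symmetry P * symmetry P = 4 • (P * P) - 4 • P + 1 := by unfold symmetry; noncomm_ring
    _ = 1 := by rw [h1]; simp

theorem star_symmetry {P : A} (hP : IsStarProjection P) : star (symmetry P) = symmetry P := by
  have h2 : star P = P := hP.isSelfAdjoint
  rw [symmetry, star_sub, star_nsmul, h2, star_one]

theorem symmetry_mul_eq_neg {P X : A} (hX : P * X + X * P = X) :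
    symmetry P * X = -(X * symmetry P) := by
  rw [← add_eq_zero_iff_eq_neg]
  calc symmetry P * X + X * symmetry P = 2 • (P * X + X * P) - 2 • X := by
        unfold symmetry; noncomm_ring
    _ = 0 := by rw [hX, sub_self]

theorem mul_add_mul_eq_of_symmetry {P X : A} (h : symmetry P * X = -(X * symmetry P)) :
    P * X + X * P = X := by
  rw [← add_eq_zero_iff_eq_neg] at h
  have h2 : (2 : ℝ) • (P * X + X * P - X) = 0 := by
    rw [← h, two_smul]
    unfold symmetry
    noncomm_ring
  exact sub_eq_zero.1 ((smul_eq_zero.1 h2).resolve_left two_ne_zero)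

theorem gen_eq_neg_symmetry_mul {P X : A} (hX : P * X + X * P = X) :
    gen P X = -(symmetry P * X) := by
  rw [← add_eq_zero_iff_eq_neg]
  calc gen P X + symmetry P * X = (P * X + X * P) - X := by
        unfold symmetry gen; noncomm_ring
    _ = 0 := by rw [hX, sub_self]

theorem symmetry_mul_gen {P X : A} (hX : P * X + X * P = X) :
    symmetry P * gen P X = -(gen P X * symmetry P) := by
  have h : X * symmetry P = -(symmetry P * X) := by rw [symmetry_mul_eq_neg hX, neg_neg]
  rw [gen_eq_neg_symmetry_mul hX, neg_mul, neg_neg, mul_assoc, h]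

theorem norm_gen {P X : A} (hP : IsStarProjection P) (hX : P * X + X * P = X) :
    ‖gen P X‖ = ‖X‖ := by
  rw [gen_eq_neg_symmetry_mul hX, norm_neg]
  exact CStarRing.norm_mem_unitary_mul X (U := symmetry P)
    (by rw [Unitary.mem_iff, star_symmetry hP]; exact ⟨symmetry_mul_self hP, symmetry_mul_self hP⟩)

theorem gen_smul (P : A) (c : ℝ) (X : A) : gen P (c • X) = c • gen P X := by
  simp [gen, smul_sub]

/-- The generators of tangent vectors are exactly the skew-adjoint elements anticommuting with
the symmetry. -/
theorem exists_gen_eq {P z : A} (hP : IsStarProjection P) (hs : star z = -z)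
    (hz : symmetry P * z = -(z * symmetry P)) : ∃ X : tangentSpace P, gen P X = z := by
  have hz' := mul_add_mul_eq_of_symmetry hz
  have hPP : P * P = P := hP.isIdempotentElem
  have hs' : star P = P := hP.isSelfAdjoint
  have h3 : P * z * P = 0 := by
    have h4 : P * z * P + P * z * P = P * z * P := by
      calc P * z * P + P * z * P = (P * P) * z * P + P * z * (P * P) := by rw [hPP]
        _ = P * (P * z + z * P) * P := by noncomm_ring
        _ = _ := by rw [hz']
    simpa using h4
  refine ⟨⟨z * P - P * z, ⟨by simp [hs, hs']; abel, ?_⟩⟩, ?_⟩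
  · calc P * (z * P - P * z) + (z * P - P * z) * P = z * (P * P) - (P * P) * z := by noncomm_ring
      _ = _ := by rw [hPP]
  · exact gen_gen hz' hPP

theorem symmetry_mul_exp {P a : A} (hP : IsStarProjection P)
    (ha : symmetry P * a = -(a * symmetry P)) :
    symmetry P * NormedSpace.exp a = NormedSpace.exp (-a) * symmetry P := by
  have h := symmetry_mul_self hP
  have h1 := exp_conj_of_sq_eq_one h a
  have h2 : symmetry P * a * symmetry P = -a := by rw [ha, neg_mul, mul_assoc, h, mul_one]
  rw [h2] at h1
  rw [h1, mul_assoc, h, mul_one]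

/-- Writing `P = (1 + ε) / 2`, the exponential map becomes `Exp_P(W) = (1 + e^{2w} ε) / 2`. -/
theorem grExp_eq {P : A} (hP : IsStarProjection P) (W : tangentSpace P) :
    grExp P W = (2⁻¹ : ℝ) • (1 + NormedSpace.exp (gen P W + gen P W) * symmetry P) := by
  have h2 : P = (2⁻¹ : ℝ) • (1 + symmetry P) := by
    rw [symmetry, add_sub_cancel, ← Nat.cast_smul_eq_nsmul ℝ, smul_smul]
    simp
  have h3 := symmetry_mul_exp (a := -gen P W) hP
    (by rw [mul_neg, symmetry_mul_gen W.2.2, neg_mul])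
  rw [neg_neg] at h3
  have h4 : grExp P W = NormedSpace.exp (gen P W) * ((2⁻¹ : ℝ) • (1 + symmetry P)) *
      NormedSpace.exp (-gen P W) :=
    congrArg (fun p => NormedSpace.exp (gen P W) * p * NormedSpace.exp (-gen P W)) h2
  rw [exp_add_self, mul_assoc, ← h3, h4]
  rw [mul_smul_comm, smul_mul_assoc, mul_add, add_mul, mul_one, exp_mul_exp_neg, mul_assoc]

theorem symmetry_grExp {P : A} (hP : IsStarProjection P) (W : tangentSpace P) :
    symmetry (grExp P W) = NormedSpace.exp (gen P W + gen P W) * symmetry P := by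
  rw [symmetry, grExp_eq hP, ← Nat.cast_smul_eq_nsmul ℝ, smul_smul]
  simp

theorem fderiv_grExp {P : A} (hP : IsStarProjection P) (W X : tangentSpace P) :
    fderiv ℝ (grExp P) W X = dexp (gen P W + gen P W) (gen P X) * symmetry P := by
  let G : tangentSpace P →L[ℝ] A :=
    ((ContinuousLinearMap.mul ℝ A).flip P - ContinuousLinearMap.mul ℝ A P).comp
      (tangentSpace P).subtypeL
  have hG : ∀ Y : tangentSpace P, (G + G) Y = gen P Y + gen P Y := fun Y => rfl
  have h1 : HasFDerivAt (fun Y : tangentSpace P => NormedSpace.exp ((G + G) Y))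
      ((dexp ((G + G) W)).comp (G + G)) W :=
    HasFDerivAt.comp W (hasFDerivAt_exp _) (G + G).hasFDerivAt
  have h2 := ((h1.mul_const' (symmetry P)).const_add 1).const_smul (2⁻¹ : ℝ)
  have h3 : grExp P = fun Y : tangentSpace P =>
      (2⁻¹ : ℝ) • (1 + NormedSpace.exp ((G + G) Y) * symmetry P) :=
    funext fun Y => by rw [grExp_eq hP, hG]
  have h4 := h2.fderiv
  rw [h3]
  refine (congrArg (fun L : tangentSpace P →L[ℝ] A => L X) h4).trans ?_
  change (2⁻¹ : ℝ) • (dexp ((G + G) W) ((G + G) X) * symmetry P) = _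
  rw [hG, hG, map_add, add_mul, ← two_smul ℝ, smul_smul]
  simp

theorem dExp_injective {P : A} (hP : IsStarProjection P) (W : tangentSpace P)
    (hu : IsUnit (dexp (gen P W + gen P W))) : Function.Injective (dExp hP W) := by
  rw [injective_iff_map_eq_zero]
  intro X hX
  have h1 : dexp (gen P W + gen P W) (gen P X) * symmetry P = 0 := by
    rw [← fderiv_grExp hP]
    exact congrArg Subtype.val hX
  have h2 : dexp (gen P W + gen P W) (gen P X) = 0 := by
    rw [← mul_one (dexp _ _), ← symmetry_mul_self hP, ← mul_assoc, h1, zero_mul]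
  have h3 : gen P X = 0 := (injective_iff_map_eq_zero _).1
    (ContinuousLinearMap.isUnit_iff_bijective.1 hu).1 _ h2
  have h4 := gen_gen X.2.2 hP.isIdempotentElem
  rw [h3, zero_mul, mul_zero, sub_self] at h4
  exact Subtype.ext h4.symm

/-- The derivative of the exponential respects the symmetries that cut out the tangent spaces,
so that its preimages of tangent vectors are generators of tangent vectors. -/
theorem dExp_surjective {P : A} (hP : IsStarProjection P) (W : tangentSpace P)
    (hu : IsUnit (dexp (gen P W + gen P W))) (hu' : IsUnit (dexp (-(gen P W + gen P W)))) :
    Function.Surjective (dExp hP W) := by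
  intro Y
  set a := gen P W + gen P W with ha
  set ε := symmetry P with hε
  have hεε : ε * ε = 1 := symmetry_mul_self hP
  have has : star a = -a := by rw [ha, star_add, star_gen hP W.2]; abel
  have haε : ε * a = -(a * ε) := by
    rw [ha, mul_add, hε, symmetry_mul_gen W.2.2, add_mul, neg_add]
  have hεaε : ε * a * ε = -a := by rw [haε, neg_mul, mul_assoc, hεε, mul_one]
  have hYs : star (Y : A) = Y := Y.2.1
  have hinj := (ContinuousLinearMap.isUnit_iff_bijective.1 hu').1
  obtain ⟨z, hz⟩ := (ContinuousLinearMap.isUnit_iff_bijective.1 hu).2 ((Y : A) * ε)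
  -- `z*`, `ε z ε` and `-z` have the same image under the injective `dexp (-a)`
  have e1 : dexp (-a) (star z) = ε * Y := by
    rw [← has, dexp_star, hz, star_mul, hYs, hε, star_symmetry hP]
  have e2 : dexp (-a) (ε * z * ε) = ε * Y := by
    rw [← hεaε, dexp_conj hεε, hz, mul_assoc, mul_assoc, hεε, mul_one]
  have e3 : dexp (-a) (-z) = ε * Y := by
    have hR := symmetry_mul_eq_neg Y.2.2
    rw [symmetry_grExp hP, ← ha, ← hε] at hR
    have hc : ε * NormedSpace.exp (-a) = NormedSpace.exp a * ε := by
      have := symmetry_mul_exp (a := -a) hP (by rw [mul_neg, ← hε, haε, neg_mul])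
      rwa [neg_neg] at this
    rw [map_neg, dexp_neg, hz]
    calc -(NormedSpace.exp (-a) * ((Y : A) * ε) * NormedSpace.exp (-a))
        = NormedSpace.exp (-a) * -((Y : A) * (ε * NormedSpace.exp (-a))) := by noncomm_ring
      _ = NormedSpace.exp (-a) * (NormedSpace.exp a * ε * Y) := by rw [hc, hR]
      _ = ε * Y := by rw [← mul_assoc, ← mul_assoc, exp_neg_mul_exp, one_mul]
  have f1 : star z = -z := hinj (e1.trans e3.symm)
  have f2 : ε * z * ε = -z := hinj (e2.trans e3.symm)
  have f3 : ε * z = -(z * ε) := by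
    rw [← neg_mul, ← f2, mul_assoc, hεε, mul_one]
  obtain ⟨X, hX⟩ := exists_gen_eq hP f1 f3
  refine ⟨X, Subtype.ext ?_⟩
  change fderiv ℝ (grExp P) W X = Y
  rw [fderiv_grExp hP, hX, ← ha, hz, mul_assoc, hεε, mul_one]

theorem isClosed_tangentSpace (P : A) : IsClosed (tangentSpace P : Set A) := by
  have h : (tangentSpace P : Set A) = {X | star X = X} ∩ {X | P * X + X * P = X} := rfl
  rw [h]
  exact (isClosed_eq (by fun_prop) (by fun_prop)).inter (isClosed_eq (by fun_prop) (by fun_prop))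

instance (P : A) : CompleteSpace (tangentSpace P) :=
  (isClosed_tangentSpace P).completeSpace_coe

theorem isInvertible_of_bijective {P Q : A} {f : tangentSpace P →L[ℝ] tangentSpace Q}
    (hf : Function.Bijective f) : f.IsInvertible :=
  ⟨ContinuousLinearEquiv.ofBijective f (LinearMap.ker_eq_bot.2 hf.1)
    (LinearMap.range_eq_top.2 hf.2),
    ContinuousLinearEquiv.coe_ofBijective f _ _⟩

/-- Before time `π / 2` the differential of the exponential map is invertible. -/
theorem not_isConjugate_of_lt [Nontrivial A] {P h : A} (hP : IsStarProjection P)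
    (V : tangentSpace P) (hh : IsSelfAdjoint h) (hn : ‖h‖ ≤ 1) (hv : gen P V = Complex.I • h)
    {t : ℝ} (ht : |t| < Real.pi / 2) : ¬ IsConjugate hP V t := by
  have h1 : gen P ((t • V : tangentSpace P) : A) + gen P ((t • V : tangentSpace P) : A) =
      (2 * t) • Complex.I • h := by
    rw [Submodule.coe_smul, gen_smul, hv, ← add_smul, two_mul]
  have h2 : |2 * t| < Real.pi := by rw [abs_mul, abs_two]; linarith
  have h3 : IsUnit (dexp ((2 * t) • Complex.I • h)) := isUnit_dexp hh hn h2
  have h4 : IsUnit (dexp (-((2 * t) • Complex.I • h))) := by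
    rw [← neg_smul]
    exact isUnit_dexp hh hn (by rwa [abs_neg])
  rw [← h1] at h3 h4
  exact not_not.2 (isInvertible_of_bijective ⟨dExp_injective hP _ h3, dExp_surjective hP _ h3 h4⟩)

/-- The range of the Sylvester operator of `u = e^{π v / 2}`, `v = i h`, misses `2 h ε`: since
`u` acts as `i` on approximate eigenvectors of `h` for `1` and `ε` maps them to approximate
eigenvectors for `-1`, on which `u` acts as `-i`, the compression of `u y + y u` to them vanishes
asymptotically. -/
theorem sylvester_exp_mul_ne {h ε : A} (hh : IsSelfAdjoint h)
    (h1 : (1 : ℝ) ∈ spectrum ℝ h) (hεε : ε * ε = 1) (hε : ε * h = -(h * ε)) (y : A) :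
    sylvester (NormedSpace.exp ((Real.pi / 2) • Complex.I • h)) y * ε ≠ (2 : ℝ) • h := by
  intro hy
  obtain ⟨g, hg1, hgg, hcomm, hlim⟩ := exists_approx_eigenvectors hh h1
  have hN : IsStarNormal h := hh.isStarNormal
  set u := NormedSpace.exp ((Real.pi / 2) • Complex.I • h) with hu
  set w := NormedSpace.exp ((-(Real.pi / 2)) • Complex.I • h) with hw
  have huf := exp_smul_I_smul hh (Real.pi / 2)
  have hwf := exp_smul_I_smul hh (-(Real.pi / 2))
  rw [← hu] at huf
  rw [← hw] at hwf
  have hεu : ε * u = w * ε := by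
    have e1 : ε * ((Real.pi / 2) • Complex.I • h) * ε = (-(Real.pi / 2)) • Complex.I • h := by
      simp only [mul_smul_comm, smul_mul_assoc, hε, neg_mul, mul_assoc, hεε, mul_one, smul_neg,
        neg_smul]
    have e2 := exp_conj_of_sq_eq_one hεε ((Real.pi / 2) • Complex.I • h)
    rw [e1, ← hw, ← hu] at e2
    rw [e2, mul_assoc, hεε, mul_one]
  have l1 : Tendsto (fun n => u * g n - Complex.I • g n) atTop (𝓝 0) := by
    have := hlim _ (by fun_prop : Continuous fun z : ℂ =>
      Complex.exp ((Real.pi / 2 : ℝ) * Complex.I * z))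
    rw [← huf] at this
    simpa [Complex.exp_pi_div_two_mul_I] using this
  have l2 : Tendsto (fun n => w * g n + Complex.I • g n) atTop (𝓝 0) := by
    have := hlim _ (by fun_prop : Continuous fun z : ℂ =>
      Complex.exp ((-(Real.pi / 2) : ℝ) * Complex.I * z))
    rw [← hwf] at this
    simpa [Complex.exp_neg, Complex.exp_pi_div_two_mul_I] using this
  have l3 : Tendsto (fun n => h * g n - g n) atTop (𝓝 0) := by
    have := hlim _ continuous_id
    rw [cfc_id ℂ h] at this
    simpa using this
  have hcw : ∀ n, g n * w = w * g n := fun n => by rw [hwf]; exact hcomm _ n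
  have hbd : ∀ {s : ℕ → A}, Tendsto s atTop (𝓝 0) →
      Tendsto (fun n => s n * (ε * y * g n)) atTop (𝓝 0) ∧
      Tendsto (fun n => g n * (ε * y) * s n) atTop (𝓝 0) ∧
      Tendsto (fun n => g n * s n) atTop (𝓝 0) := fun {s} hs => by
    have hb : ∀ c : A, IsBoundedUnder (· ≤ ·) atTop (fun n => ‖c * g n‖) := fun c =>
      isBoundedUnder_of ⟨‖c‖, fun n => (norm_mul_le _ _).trans (by rw [hg1, mul_one])⟩
    have hb' : ∀ c : A, IsBoundedUnder (· ≤ ·) atTop (fun n => ‖g n * c‖) := fun c =>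
      isBoundedUnder_of ⟨‖c‖, fun n => (norm_mul_le _ _).trans (by rw [hg1, one_mul])⟩
    refine ⟨hs.zero_mul_isBoundedUnder_le (hb _), isBoundedUnder_le_mul_tendsto_zero (hb' _) hs, ?_⟩
    have := isBoundedUnder_le_mul_tendsto_zero (hb' 1) hs
    simpa using this
  have key : ∀ n, (w * g n + Complex.I • g n) * (ε * y * g n) +
      g n * (ε * y) * (u * g n - Complex.I • g n) + (2 : ℝ) • (g n * (h * g n - g n)) =
      -((2 : ℝ) • (g n * g n)) := fun n => by
    have e1 : u * y + y * u = (2 : ℝ) • (h * ε) := by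
      rw [← smul_mul_assoc, ← hy, mul_assoc, hεε, mul_one, sylvester_apply]
    have e2 : g n * ε * (u * y + y * u) * g n = -((2 : ℝ) • (g n * h * g n)) := by
      have : ε * (h * ε) = -h := by rw [← mul_assoc, hε, neg_mul, mul_assoc, hεε, mul_one]
      rw [e1, mul_smul_comm, smul_mul_assoc, mul_assoc (g n), this, mul_neg, neg_mul, smul_neg]
    have e3 : g n * ε * (u * y + y * u) * g n =
        (w * g n) * (ε * y * g n) + g n * (ε * y) * (u * g n) := by
      calc g n * ε * (u * y + y * u) * g n
          = g n * (ε * u) * y * g n + g n * (ε * y) * (u * g n) := by noncomm_ring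
        _ = (g n * w) * (ε * y * g n) + g n * (ε * y) * (u * g n) := by rw [hεu]; noncomm_ring
        _ = _ := by rw [hcw]
    rw [add_mul, mul_sub, smul_mul_assoc, mul_smul_comm, mul_sub, smul_sub, ← mul_assoc (g n) h]
    have e4 := e3.symm.trans e2
    rw [eq_neg_iff_add_eq_zero] at e4
    rw [eq_neg_iff_add_eq_zero, ← e4]
    rw [show g n * (ε * y * g n) = g n * (ε * y) * g n by noncomm_ring]
    abel
  have hlim0 : Tendsto (fun n => -((2 : ℝ) • (g n * g n))) atTop (𝓝 0) := by
    have := ((hbd l2).1.add (hbd l1).2.1).add ((hbd l3).2.2.const_smul (2 : ℝ))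
    simp only [add_zero, smul_zero] at this
    exact this.congr key
  have h2 : ∀ n, ‖-((2 : ℝ) • (g n * g n))‖ = 2 := fun n => by
    rw [norm_neg, norm_smul, hgg]; simp
  have h3 := hlim0.norm
  simp only [h2, norm_zero] at h3
  exact two_ne_zero (tendsto_nhds_unique tendsto_const_nhds h3)

theorem one_mem_spectrum_of_anticomm [Nontrivial A] {h ε : A} (hh : IsSelfAdjoint h)
    (hn : ‖h‖ = 1) (hεε : ε * ε = 1) (hε : ε * h = -(h * ε)) : (1 : ℝ) ∈ spectrum ℝ h := by
  rcases CStarAlgebra.norm_or_neg_norm_mem_spectrum hh with h1 | h1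
  · rwa [hn] at h1
  · rw [hn] at h1
    have h2 : ε * h * ε = -h := by rw [hε, neg_mul, mul_assoc, hεε, mul_one]
    have h3 := spectrum.units_conjugate (R := ℝ) (a := h) (u := ⟨ε, ε, hεε, hεε⟩)
    change spectrum ℝ (ε * h * ε) = _ at h3
    rw [h2, ← spectrum.neg_eq] at h3
    rw [← h3]
    simpa using h1

/-- At time `π / 2` the tangent vector `h = -i [V, P]`, which the geodesic transports to itself,
is not in the range of the differential. -/
theorem isEpiconjugate_pi_div_two [Nontrivial A] {P h : A} (hP : IsStarProjection P)
    (V : tangentSpace P) (hh : IsSelfAdjoint h) (hn : ‖h‖ = 1) (hv : gen P V = Complex.I • h)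
    (hε : symmetry P * h = -(h * symmetry P)) : IsEpiconjugate hP V (Real.pi / 2) := by
  intro hsurj
  have hεε := symmetry_mul_self hP
  have hw : gen P (((Real.pi / 2) • V : tangentSpace P) : A) = (Real.pi / 2) • Complex.I • h := by
    rw [Submodule.coe_smul, gen_smul, hv]
  have hmem : h ∈ tangentSpace (grExp P ((Real.pi / 2) • V)) := by
    refine ⟨hh, mul_add_mul_eq_of_symmetry ?_⟩
    rw [symmetry_grExp hP, hw, mul_assoc, hε]
    have hc : Commute h (NormedSpace.exp
        ((Real.pi / 2) • Complex.I • h + (Real.pi / 2) • Complex.I • h)) := by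
      let +nondep : NormedAlgebra ℚ A := .restrictScalars ℚ ℂ A
      refine Commute.exp_right ?_
      have : Commute h ((Real.pi / 2) • Complex.I • h) :=
        ((Commute.refl h).smul_right _).smul_right _
      exact this.add_right this
    rw [mul_neg, ← mul_assoc, ← hc.eq, mul_assoc]
  obtain ⟨X, hX⟩ := hsurj ⟨h, hmem⟩
  have h1 : fderiv ℝ (grExp P) ((Real.pi / 2) • V) X = h := congrArg Subtype.val hX
  rw [fderiv_grExp hP, hw, dexp_add_self_eq] at h1
  refine sylvester_exp_mul_ne hh (one_mem_spectrum_of_anticomm hh hn hεε hε) hεε hε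
    (dexp ((Real.pi / 2) • Complex.I • h) (gen P X)) ?_
  conv_rhs => rw [← h1]
  rw [_root_.smul_apply, smul_mul_assoc, smul_smul, mul_inv_cancel₀ two_ne_zero, one_smul]
  rfl

/-- If `v² y = -y` and `v y = -y v`, then `y` is tangent to the conjugation orbit of `v`, and the
exponential can be differentiated explicitly in the direction `y`. -/
theorem smul_dexp_eq_commutator {v y : A} (h1 : v * (v * y) = -y) (h2 : v * y = -(y * v)) (θ : ℝ) :
    dexp (θ • v) (θ • y) = (2⁻¹ : ℝ) • (v * y * NormedSpace.exp (θ • v) -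
      NormedSpace.exp (θ • v) * (v * y)) := by
  have h3 : (2⁻¹ : ℝ) • (v * y) * (θ • v) - θ • v * ((2⁻¹ : ℝ) • (v * y)) = θ • y := by
    have h4 : v * y * v = y := by
      have : y * v = -(v * y) := by rw [h2, neg_neg]
      rw [mul_assoc, this, mul_neg, h1, neg_neg]
    simp only [smul_mul_assoc, mul_smul_comm, h1, h4]
    module
  rw [← h3, dexp_commutator, smul_mul_assoc, mul_smul_comm, smul_sub]

/-- The kernel of the differential at time `π / 2`, in terms of generators. -/
theorem dExp_pi_div_two_eq_zero_iff [Nontrivial A] {P h : A} (hP : IsStarProjection P)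
    (V : tangentSpace P) (hh : IsSelfAdjoint h) (hn : ‖h‖ ≤ 1) (hv : gen P V = Complex.I • h)
    (X : tangentSpace P) : dExp hP ((Real.pi / 2) • V) X = 0 ↔
      gen P V * (gen P V * gen P X) = -gen P X ∧ gen P V * gen P X = -(gen P X * gen P V) := by
  have hεε := symmetry_mul_self hP
  set v := gen P V with hvdef
  set x := gen P X with hx
  have hvs : star v = -v := star_gen hP V.2
  have hxs : star x = -x := star_gen hP X.2
  have hw : gen P (((Real.pi / 2) • V : tangentSpace P) : A) = (Real.pi / 2) • v := by
    rw [Submodule.coe_smul, gen_smul]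
  have h0 : dExp hP ((Real.pi / 2) • V) X = 0 ↔
      dexp ((Real.pi / 2) • v + (Real.pi / 2) • v) x = 0 := by
    rw [Subtype.ext_iff]
    change fderiv ℝ (grExp P) _ X = 0 ↔ _
    rw [fderiv_grExp hP, hw]
    refine ⟨fun h => ?_, fun h => by rw [h, zero_mul]⟩
    rw [← mul_one (dexp _ _), ← hεε, ← mul_assoc, h, zero_mul]
  rw [h0]
  constructor
  · intro h
    rw [dexp_add_self_eq] at h
    have hy : sylvester (NormedSpace.exp ((Real.pi / 2) • v)) (dexp ((Real.pi / 2) • v) x) = 0 :=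
      (smul_eq_zero.1 h).resolve_left (by norm_num)
    set y := dexp ((Real.pi / 2) • v) x with hydef
    have hy' := hy
    rw [hv] at hy'
    obtain ⟨k1, k2⟩ := of_sylvester_exp_eq_zero hh hn hy'
    rw [← hv] at k1 k2
    rw [sylvester_apply] at hy
    have e1 : NormedSpace.exp ((Real.pi / 2) • v) * y = v * y := by
      simpa using exp_smul_mul_of_sq k1 (Real.pi / 2)
    have e2 : NormedSpace.exp ((Real.pi / 2) • v) * (v * y) = -y := by
      rw [← k1]
      simpa using exp_smul_mul_of_sq (x := v * y) (by rw [k1, mul_neg]) (Real.pi / 2)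
    -- `dexp` at `π v / 2` is injective and sends both `x` and `(π / 2) y` to `y`
    have e3 : dexp ((Real.pi / 2) • v) ((Real.pi / 2) • y) = y := by
      rw [smul_dexp_eq_commutator k1 k2, mul_assoc,
        eq_neg_of_add_eq_zero_right hy, e1, mul_neg, k1, e2]
      module
    have hinj : Function.Injective (dexp ((Real.pi / 2) • v)) := by
      rw [hv]
      refine (ContinuousLinearMap.isUnit_iff_bijective.1 (isUnit_dexp hh hn ?_)).1
      rw [abs_of_pos (by positivity)]
      linarith [Real.pi_pos]
    have e4 : x = (Real.pi / 2) • y := hinj (by rw [e3])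
    rw [e4]
    simp only [mul_smul_comm, smul_mul_assoc, k1, smul_neg, true_and]
    rw [k2, smul_neg]
  · rintro ⟨k1, k2⟩
    have e1 := smul_dexp_eq_commutator k1 k2 Real.pi
    have e2 : NormedSpace.exp (Real.pi • v) * (v * x) = -(v * x) := by
      simpa using exp_smul_mul_of_sq (x := v * x) (by rw [k1, mul_neg]) Real.pi
    have e3 : x * NormedSpace.exp (Real.pi • v) = -x := by
      simpa using mul_exp_smul_of_sq (x := x) hvs (by rw [hxs, mul_neg, mul_neg, k1]) Real.pi
    rw [mul_assoc, e3, e2, mul_neg, sub_self, smul_zero, map_smul] at e1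
    rw [← add_smul, add_halves]
    exact (smul_eq_zero.1 e1).resolve_left Real.pi_ne_zero

end Differential

/-! ### Corners, the kernel in terms of `|λ|`, and the operator `L_{|λ|} + R_{|λ|} - 2` -/

section Corner

open Filter

variable {A : Type*} [CStarAlgebra A]

theorem mul_corner {P : A} (hP : IsStarProjection P) (X : A) : P * corner P X = corner P X := by
  rw [corner, ← mul_assoc, ← mul_assoc, hP.isIdempotentElem.eq]

theorem corner_mul {P : A} (hP : IsStarProjection P) (X : A) : corner P X * P = 0 := by
  rw [corner, mul_assoc, sub_mul, one_mul, hP.isIdempotentElem.eq, sub_self, mul_zero]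

theorem mul_star_corner {P : A} (hP : IsStarProjection P) (X : A) :
    P * star (corner P X) = 0 := by
  have h := congrArg star (corner_mul hP X)
  rwa [star_mul, hP.isSelfAdjoint.star_eq, star_zero] at h

theorem star_corner_mul {P : A} (hP : IsStarProjection P) (X : A) :
    star (corner P X) * P = star (corner P X) := by
  have h := congrArg star (mul_corner hP X)
  rwa [star_mul, hP.isSelfAdjoint.star_eq] at h

theorem corner_mul_corner {P : A} (hP : IsStarProjection P) (X Y : A) :
    corner P X * corner P Y = 0 := by
  rw [← mul_corner hP Y, ← mul_assoc, corner_mul hP, zero_mul]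

theorem star_corner_mul_star_corner {P : A} (hP : IsStarProjection P) (X Y : A) :
    star (corner P X) * star (corner P Y) = 0 := by
  rw [← star_mul, corner_mul_corner hP, star_zero]

theorem corner_add_star_corner {P X : A} (hP : IsStarProjection P) (hX : X ∈ tangentSpace P) :
    corner P X + star (corner P X) = X := by
  have h1 : star (corner P X) = (1 - P) * X * P := by
    simp [corner, hP.isSelfAdjoint.star_eq, hX.1, mul_assoc]
  rw [h1]
  exact ((mem_tangentSpace_iff_codiag hP).1 hX).2

theorem gen_eq_star_corner_sub {P X : A} (hP : IsStarProjection P) (hX : X ∈ tangentSpace P) :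
    gen P X = star (corner P X) - corner P X := by
  have h := corner_add_star_corner hP hX
  rw [gen]
  nth_rewrite 1 [← h]
  nth_rewrite 3 [← h]
  rw [add_mul, mul_add, corner_mul hP, star_corner_mul hP, mul_corner hP, mul_star_corner hP,
    zero_add, add_zero]

/-- Since `V² = λλ* + λ*λ` is block diagonal, `λ` has the norm of `V`. -/
theorem norm_corner {P V : A} (hP : IsStarProjection P) (hV : V ∈ tangentSpace P) :
    ‖corner P V‖ = ‖V‖ := by
  let _ : PartialOrder A := CStarAlgebra.spectralOrder A
  have : StarOrderedRing A := CStarAlgebra.spectralOrderedRing A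
  have hPs : star P = P := hP.isSelfAdjoint
  set l := corner P V with hl
  refine le_antisymm ?_ ?_
  · have h1 : ‖P‖ ≤ 1 := hP.norm_le
    have h2 : ‖1 - P‖ ≤ 1 := hP.one_sub.norm_le
    calc ‖l‖ ≤ ‖P‖ * ‖V‖ * ‖1 - P‖ :=
          (norm_mul_le _ _).trans (mul_le_mul_of_nonneg_right (norm_mul_le _ _) (norm_nonneg _))
      _ ≤ 1 * ‖V‖ * 1 := by gcongr
      _ = ‖V‖ := by ring
  · have hVV : star V * V = star P * (l * star l) * P + star (1 - P) * (star l * l) * (1 - P) := by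
      rw [star_sub, star_one, hPs, hV.1]
      have e1 : P * (l * star l) * P = l * star l := by
        rw [← mul_assoc, mul_corner hP, mul_assoc, star_corner_mul hP]
      have e2 : (1 - P) * (star l * l) * (1 - P) = star l * l := by
        rw [← mul_assoc, sub_mul, one_mul, mul_star_corner hP, sub_zero, mul_assoc, mul_sub,
          mul_one, corner_mul hP, sub_zero]
      rw [e1, e2]
      conv_lhs => rw [← corner_add_star_corner hP hV]
      rw [add_mul, mul_add, mul_add, corner_mul_corner hP, star_corner_mul_star_corner hP]
      abel
    have k1 : l * star l ≤ algebraMap ℝ A (‖l‖ ^ 2) := by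
      simpa using CStarAlgebra.star_mul_le_algebraMap_norm_sq (a := star l)
    have k2 : star l * l ≤ algebraMap ℝ A (‖l‖ ^ 2) := CStarAlgebra.star_mul_le_algebraMap_norm_sq
    have k3 : star V * V ≤ algebraMap ℝ A (‖l‖ ^ 2) := by
      rw [hVV]
      refine (add_le_add (star_left_conjugate_le_conjugate k1 P)
        (star_left_conjugate_le_conjugate k2 (1 - P))).trans_eq ?_
      rw [star_sub, star_one, hPs, ← Algebra.commutes, mul_assoc, hP.isIdempotentElem.eq,
        ← Algebra.commutes, mul_assoc, hP.one_sub.isIdempotentElem.eq, ← mul_add,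
        add_sub_cancel, mul_one]
    have k4 := CStarAlgebra.norm_le_norm_of_nonneg_of_le (star_mul_self_nonneg V) k3
    rw [CStarRing.norm_star_mul_self] at k4
    have k5 : ‖algebraMap ℝ A (‖l‖ ^ 2)‖ ≤ ‖l‖ ^ 2 := by
      rcases subsingleton_or_nontrivial A with _ | _
      · rw [Subsingleton.elim (algebraMap ℝ A _) 0, norm_zero]
        positivity
      · rw [norm_algebraMap', Real.norm_of_nonneg (by positivity)]
    nlinarith [norm_nonneg V, norm_nonneg l]

theorem norm_absVal (a : A) : ‖absVal a‖ = ‖a‖ := by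
  have h := CStarRing.norm_star_mul_self (x := absVal a)
  rw [(isSelfAdjoint_absVal a).star_eq, absVal_mul_absVal, CStarRing.norm_star_mul_self] at h
  exact ((mul_self_inj (norm_nonneg _) (norm_nonneg _)).1 h).symm

/-- As `|a|` is positive, `-1` is not an eigenvalue of it. -/
theorem absVal_mul_eq_of_sq {a z : A} (hz : star a * a * z = z) : absVal a * z = z := by
  let _ : PartialOrder A := CStarAlgebra.spectralOrder A
  have : StarOrderedRing A := CStarAlgebra.spectralOrderedRing A
  have hnonneg : 0 ≤ absVal a := cfc_nonneg fun x _ => Real.sqrt_nonneg x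
  have h1 : absVal a * (absVal a * z - z) = -(absVal a * z - z) := by
    rw [mul_sub, ← mul_assoc, absVal_mul_absVal, hz, neg_sub]
  set d := absVal a * z - z with hd
  have h2 : 0 ≤ -(star d * d) := by
    have := star_left_conjugate_nonneg hnonneg d
    rwa [mul_assoc, h1, mul_neg] at this
  have h3 : star d * d = 0 := le_antisymm (neg_nonneg.1 h2) (star_mul_self_nonneg d)
  exact sub_eq_zero.1 ((CStarRing.star_mul_self_eq_zero_iff d).1 h3)

theorem corner_mul_sub_mem_tangentSpace {P V z : A} (hP : IsStarProjection P)
    (hz : absVal (corner P V) * z = z) (hzs : star z = -z) :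
    P * z = 0 ∧ z * P = 0 ∧ corner P V * z - z * star (corner P V) ∈ tangentSpace P := by
  have h1 : z = star (corner P V) * corner P V * z := by
    rw [← absVal_mul_absVal, mul_assoc, hz, hz]
  have h2 : P * z = 0 := by
    rw [h1, mul_assoc, ← mul_assoc, mul_star_corner hP, zero_mul]
  have h3 : z * P = 0 := by
    have := congrArg star h2
    rwa [star_mul, hzs, hP.isSelfAdjoint.star_eq, star_zero, neg_mul, neg_eq_zero] at this
  refine ⟨h2, h3, ?_, ?_⟩
  · simp only [star_sub, star_mul, star_star, hzs]
    noncomm_ring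
  · rw [mul_sub, sub_mul, ← mul_assoc, mul_corner hP, ← mul_assoc, h2, zero_mul, mul_assoc, h3,
      mul_zero, mul_assoc, star_corner_mul hP, sub_zero, zero_sub, ← sub_eq_add_neg]

theorem corner_corner_mul_sub {P V z : A} (hP : IsStarProjection P)
    (h2 : P * z = 0) (h3 : z * P = 0) :
    corner P (corner P V * z - z * star (corner P V)) = corner P V * z := by
  have h4 : P * (corner P V * z - z * star (corner P V)) = corner P V * z := by
    rw [mul_sub, ← mul_assoc, mul_corner hP, ← mul_assoc P z, h2, zero_mul, sub_zero]
  rw [corner, h4, mul_sub, mul_one, mul_assoc, h3, mul_zero, sub_zero]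

/-- The kernel condition on generators, rewritten for `X` in terms of `z = λ* ξ`, where `ξ` is the
corner of `X`. -/
theorem gen_condition_iff {P V X : A} (hP : IsStarProjection P) (hV : V ∈ tangentSpace P)
    (hX : X ∈ tangentSpace P) :
    (gen P V * (gen P V * gen P X) = -gen P X ∧ gen P V * gen P X = -(gen P X * gen P V)) ↔
      ∃ z : A, absVal (corner P V) * z = z ∧ star z = -z ∧
        X = corner P V * z - z * star (corner P V) := by
  rw [gen_eq_star_corner_sub hP hV, gen_eq_star_corner_sub hP hX]
  have hll := corner_mul_corner hP V V
  have hll' := star_corner_mul_star_corner hP V V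
  have hlx := corner_mul_corner hP V X
  have hlx' := star_corner_mul_star_corner hP V X
  have hxl := corner_mul_corner hP X V
  have hxl' := star_corner_mul_star_corner hP X V
  have hPl := mul_corner hP V
  have hPl' := mul_star_corner hP V
  have hPx := mul_corner hP X
  have hPx' := mul_star_corner hP X
  have hXeq := corner_add_star_corner hP hX
  constructor
  · rintro ⟨k1, k2⟩
    set l := corner P V
    set x := corner P X
    -- compressing the two equations by `1 - P` and `P` isolates their corners
    have e1 : (star l - l) * (star x - x) = -(star l * x + l * star x) := by
      rw [sub_mul, mul_sub, mul_sub, hlx, hlx']; abel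
    have e2 : (star x - x) * (star l - l) = -(star x * l + x * star l) := by
      rw [sub_mul, mul_sub, mul_sub, hxl, hxl']; abel
    rw [e1] at k1
    rw [e1, e2] at k2
    have f1 : star l * x = -(star x * l) := by
      have := congrArg (fun y => (1 - P) * y) k2
      simp only [sub_mul, one_mul, mul_neg, mul_add, ← mul_assoc, hPl, hPl', hPx, hPx', zero_mul,
        neg_add_rev, neg_neg] at this
      have h4 := congrArg Neg.neg this
      simpa using h4
    have f2 : l * (star l * x) = x := by
      have := congrArg (fun y => P * y) k1
      simp only [← mul_assoc, mul_sub, hPl, hPl', hPx, hPx', zero_sub, mul_neg, neg_mul, mul_add,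
        hll, zero_mul, neg_zero, add_zero, neg_neg] at this
      rwa [← mul_assoc]
    have f3 : star (star l * x) = -(star l * x) := by rw [star_mul, star_star, f1, neg_neg]
    refine ⟨star l * x, absVal_mul_eq_of_sq ?_, f3, ?_⟩
    · rw [mul_assoc, f2]
    · have f4 := congrArg star f2
      rw [star_mul, f3, neg_mul] at f4
      rw [f2, sub_eq_add_neg, f4, hXeq]
  · rintro ⟨z, hz, hzs, hXz⟩
    obtain ⟨h2, h3, -⟩ := corner_mul_sub_mem_tangentSpace hP hz hzs
    have hx : corner P X = corner P V * z := by rw [hXz, corner_corner_mul_sub hP h2 h3]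
    have hz1 : star (corner P V) * (corner P V * z) = z := by
      rw [← mul_assoc, ← absVal_mul_absVal, mul_assoc, hz, hz]
    have hz2 : z * star (corner P V) * corner P V = z := by
      have := congrArg star hz1
      simpa [hzs, mul_assoc] using this
    have hlz : star (corner P V) * z = 0 := by
      rw [← star_corner_mul hP, mul_assoc, h2, mul_zero]
    have hzl : z * corner P V = 0 := by
      rw [← hPl, ← mul_assoc, h3, zero_mul]
    have hxs : star (corner P V * z) = -(z * star (corner P V)) := by
      rw [star_mul, hzs, neg_mul]
    rw [hx, hxs]
    set l := corner P V
    have e1 : (star l - l) * (-(z * star l) - l * z) = l * z * star l - z := by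
      calc (star l - l) * (-(z * star l) - l * z)
          = l * z * star l - star l * (l * z) - star l * z * star l + (l * l) * z := by
            noncomm_ring
        _ = _ := by rw [hz1, hlz, hll]; simp
    have e2 : (-(z * star l) - l * z) * (star l - l) = z - l * z * star l := by
      calc (-(z * star l) - l * z) * (star l - l)
          = z * star l * l - l * z * star l - z * (star l * star l) + l * (z * l) := by
            noncomm_ring
        _ = _ := by rw [hz2, hll', hzl]; simp
    refine ⟨?_, by rw [e1, e2, neg_sub]⟩
    rw [e1]
    calc (star l - l) * (l * z * star l - z)
        = star l * (l * z) * star l - star l * z - (l * l) * (z * star l) + l * z := by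
          noncomm_ring
      _ = _ := by rw [hz1, hlz, hll]; simp; abel

/-- If `1` is in the spectrum of `S`, then `S ((S - 1) b + b (S - 1)) S` is never `S²`: compress to
approximate eigenvectors of `S` for the value `1`. -/
theorem mul_sub_two_mul_ne {S : A} (hS : IsSelfAdjoint S) (h1 : (1 : ℝ) ∈ spectrum ℝ S) (b : A) :
    S * (S * b + b * S - 2 * b) * S ≠ S * S := by
  intro hb
  obtain ⟨g, hg1, hgg, hcomm, hlim⟩ := exists_approx_eigenvectors hS h1
  have hN : IsStarNormal S := hS.isStarNormal
  have hlim := hlim _ continuous_id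
  have hcomm : ∀ n, g n * S = S * g n := fun n => by
    have := hcomm id n
    rwa [cfc_id ℂ S] at this
  rw [cfc_id ℂ S] at hlim
  simp only [id, one_smul] at hlim
  have hb1 : ∀ c : A, IsBoundedUnder (· ≤ ·) atTop (fun n => ‖c * g n‖) := fun c =>
    isBoundedUnder_of ⟨‖c‖, fun n => (norm_mul_le _ _).trans (by rw [hg1, mul_one])⟩
  have hb2 : ∀ c : A, IsBoundedUnder (· ≤ ·) atTop (fun n => ‖g n * c‖) := fun c =>
    isBoundedUnder_of ⟨‖c‖, fun n => (norm_mul_le _ _).trans (by rw [hg1, one_mul])⟩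
  have l1 := hlim.zero_mul_isBoundedUnder_le (hb1 (S * b * S))
  have l2 := isBoundedUnder_le_mul_tendsto_zero (hb2 (S * b * S)) hlim
  have l3 := isBoundedUnder_le_mul_tendsto_zero (hb2 1) hlim
  have l4 := hlim.zero_mul_isBoundedUnder_le (hb1 S)
  have key : ∀ n, (S * g n - g n) * (S * b * S * g n) + g n * (S * b * S) * (S * g n - g n) -
      g n * 1 * (S * g n - g n) - (S * g n - g n) * (S * g n) = g n * g n := fun n => by
    have e1 : g n * (S * S) * g n = (S * g n) * (S * b * S * g n) +
        g n * (S * b * S) * (S * g n) - g n * (S * b * S * g n) - g n * (S * b * S) * g n := by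
      calc g n * (S * S) * g n = (g n * S) * (S * b * S * g n) + g n * (S * b * S) * (S * g n)
          - g n * (S * b * S * g n) - g n * (S * b * S) * g n := by
            rw [← hb]
            noncomm_ring
        _ = _ := by rw [hcomm]
    have e2 : g n * (S * S) * g n = (S * g n) * (S * g n) := by
      rw [← mul_assoc, hcomm]; noncomm_ring
    calc _ = ((S * g n) * (S * b * S * g n) + g n * (S * b * S) * (S * g n)
          - g n * (S * b * S * g n) - g n * (S * b * S) * g n) - (S * g n) * (S * g n)
          + g n * g n := by noncomm_ring
      _ = _ := by rw [← e1, e2, sub_self, zero_add]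
  have h2 := (((l1.add l2).sub l3).sub l4).congr key
  simp only [add_zero, sub_zero] at h2
  have h3 := h2.norm
  simp only [hgg, norm_zero] at h3
  exact one_ne_zero (tendsto_nhds_unique tendsto_const_nhds h3)

variable {H : Type*} [NormedAddCommGroup H] [InnerProductSpace ℂ H] [CompleteSpace H]

theorem mul_rangeProj_mul_mul_rangeProj_mul {S : H →L[ℂ] H} (hS : IsSelfAdjoint S)
    (T : H →L[ℂ] H) : S * (rangeProj S * T * rangeProj S) * S = S * T * S := by
  calc S * (rangeProj S * T * rangeProj S) * S = (S * rangeProj S) * T * (rangeProj S * S) := by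
        simp only [mul_assoc]
    _ = _ := by rw [rangeProj_mul, mul_rangeProj hS]

theorem coe_leftAddRight_sub_two (ρ : A →⋆ₐ[ℂ] (H →L[ℂ] H)) (l : A) (z : A₀ ρ l) :
    ((leftAddRight ρ l - 2) z : H →L[ℂ] H) =
      ρ (absVal l) * z + z * ρ (absVal l) - 2 * (z : H →L[ℂ] H) := by
  have h2 : (2 : Module.End ℂ (A₀ ρ l)) z = z + z := by
    rw [← one_add_one_eq_two]
    rfl
  rw [LinearMap.sub_apply, h2, Submodule.coe_sub, two_mul]
  rfl

/-- `L_{|λ|} + R_{|λ|} - 2` misses the projection `P_{|λ|}`: this is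
`mul_sub_two_mul_ne` after multiplication by `|λ|` on both sides. -/
theorem not_isUnit_leftAddRight_sub_two (ρ : A →⋆ₐ[ℂ] (H →L[ℂ] H)) (hρ : Function.Injective ρ)
    {l : A} (h1 : (1 : ℝ) ∈ spectrum ℝ (absVal l)) : ¬ IsUnit (leftAddRight ρ l - 2) := by
  intro hu
  have hS : IsSelfAdjoint (ρ (absVal l)) := (isSelfAdjoint_absVal l).map ρ
  obtain ⟨⟨z, hz⟩, hzz⟩ := ((Module.End.isUnit_iff _).1 hu).2
    ⟨rangeProj (ρ (absVal l)) * ρ 1 * rangeProj (ρ (absVal l)), mem_A₀.2 ⟨1, rfl⟩⟩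
  obtain ⟨b, rfl⟩ := mem_A₀.1 hz
  set S := ρ (absVal l) with hSdef
  have h2 : S * (rangeProj S * ρ b * rangeProj S) + rangeProj S * ρ b * rangeProj S * S -
      2 * (rangeProj S * ρ b * rangeProj S) = rangeProj S * ρ 1 * rangeProj S := by
    exact (coe_leftAddRight_sub_two ρ l ⟨_, hz⟩).symm.trans (congrArg Subtype.val hzz)
  have h3 := congrArg (fun T => S * T * S) h2
  have hm := mul_rangeProj_mul_mul_rangeProj_mul hS
  have h4 : S * (S * ρ b + ρ b * S - 2 * ρ b) * S = S * S := by
    have e1 : S * (S * (rangeProj S * ρ b * rangeProj S) + rangeProj S * ρ b * rangeProj S * S -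
        2 * (rangeProj S * ρ b * rangeProj S)) * S =
        S * (S * (rangeProj S * ρ b * rangeProj S) * S) +
        (S * (rangeProj S * ρ b * rangeProj S) * S) * S -
        2 * (S * (rangeProj S * ρ b * rangeProj S) * S) := by noncomm_ring
    simp only [e1, hm] at h3
    rw [map_one, mul_one] at h3
    rw [← h3]
    noncomm_ring
  refine mul_sub_two_mul_ne (isSelfAdjoint_absVal l) h1 b (hρ ?_)
  simpa [map_ofNat] using h4

/-- The kernel elements, written with the polar decomposition in the representation, come from
elements `z` of the algebra itself: `z = |λ| z |λ|`. -/
theorem exists_mem_A₀_iff (ρ : A →⋆ₐ[ℂ] (H →L[ℂ] H)) (hρ : Function.Injective ρ) (l : A)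
    (T : H →L[ℂ] H) :
    (∃ z ∈ A₀ ρ l, ρ (absVal l) * z = z ∧ z = -star z ∧
      T = polarPart (ρ l) * z - z * star (polarPart (ρ l))) ↔
    ∃ z : A, absVal l * z = z ∧ star z = -z ∧ T = ρ (l * z - z * star l) := by
  have hS : IsSelfAdjoint (ρ (absVal l)) := (isSelfAdjoint_absVal l).map ρ
  have hpol : polarPart (ρ l) * ρ (absVal l) = ρ l := by
    rw [map_absVal]; exact polarPart_comp_absVal _
  have hpol' : ρ (absVal l) * star (polarPart (ρ l)) = ρ (star l) := by
    rw [map_star, ← hpol, star_mul, hS.star_eq, hpol]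
  have key : ∀ z : A, absVal l * z = z → star z = -z →
      polarPart (ρ l) * ρ z - ρ z * star (polarPart (ρ l)) = ρ (l * z - z * star l) := by
    intro z hz hzs
    have hz' : z * absVal l = z := by
      have := congrArg star hz
      rwa [star_mul, hzs, (isSelfAdjoint_absVal l).star_eq, neg_mul, neg_inj] at this
    have e1 : polarPart (ρ l) * ρ z = ρ (l * z) := by
      conv_lhs => rw [← hz, map_mul, ← mul_assoc, hpol, ← map_mul]
    have e2 : ρ z * star (polarPart (ρ l)) = ρ (z * star l) := by
      conv_lhs => rw [← hz', map_mul, mul_assoc, hpol', ← map_mul]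
    rw [e1, e2, map_sub]
  constructor
  · rintro ⟨z, hzA, hz, hzs, rfl⟩
    have hzs' : star z = -z := by rw [hzs, star_neg, star_star]; simp [← hzs]
    obtain ⟨a, ha⟩ := mem_A₀.1 hzA
    have hz' : z * ρ (absVal l) = z := by
      have := congrArg star hz
      rwa [star_mul, hzs', hS.star_eq, neg_mul, neg_inj] at this
    have hz2 : ρ (absVal l * a * absVal l) = z := by
      rw [map_mul, map_mul, ← mul_rangeProj_mul_mul_rangeProj_mul hS, ha, hz, hz']
    rw [← hz2] at hz hzs' ⊢
    have k1 : absVal l * (absVal l * a * absVal l) = absVal l * a * absVal l :=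
      hρ (by rw [map_mul, hz])
    have k2 : star (absVal l * a * absVal l) = -(absVal l * a * absVal l) :=
      hρ (by rw [map_star, hzs', map_neg])
    exact ⟨_, k1, k2, key _ k1 k2⟩
  · rintro ⟨z, hz, hzs, rfl⟩
    have hz' : z * absVal l = z := by
      have := congrArg star hz
      rwa [star_mul, hzs, (isSelfAdjoint_absVal l).star_eq, neg_mul, neg_inj] at this
    refine ⟨ρ z, mem_A₀.2 ⟨z, ?_⟩, by rw [← map_mul, hz], ?_, (key z hz hzs).symm⟩
    · nth_rewrite 1 [← hz]
      rw [map_mul, ← mul_assoc, rangeProj_mul, ← map_mul, hz]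
      nth_rewrite 1 [← hz']
      rw [map_mul, mul_assoc, mul_rangeProj hS, ← map_mul, hz']
    · rw [← map_star, hzs, map_neg, neg_neg]

end Corner

end CStarGrassmannian

open CStarGrassmannian
theorem theorem3 {A : Type*} [CStarAlgebra A]
    {H : Type*} [NormedAddCommGroup H] [InnerProductSpace ℂ H] [CompleteSpace H]
    (ρ : A →⋆ₐ[ℂ] (H →L[ℂ] H)) (hρ : Function.Injective ρ)
    (P₀ : A) (hP₀ : IsStarProjection P₀) (P : A) (hP : P ∈ Gr P₀)
    (V : tangentSpace P) (hV : ‖V‖ = 1) :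
    IsFirstConjugate (isStarProjection_of_mem_Gr hP₀ hP) V (Real.pi / 2) ∧
    (fun X : tangentSpace P => ρ (X : A)) ''
        {X | dExp (isStarProjection_of_mem_Gr hP₀ hP) ((Real.pi / 2) • V) X = 0} =
      {T | ∃ z ∈ A₀ ρ (corner P V),
        ρ (absVal (corner P V)) * z = z ∧ z = -star z ∧
        T = polarPart (ρ (corner P V)) * z - z * star (polarPart (ρ (corner P V)))} ∧
    (¬ IsMonoconjugate (isStarProjection_of_mem_Gr hP₀ hP) V (Real.pi / 2) →
      IsEpiconjugate (isStarProjection_of_mem_Gr hP₀ hP) V (Real.pi / 2)) ∧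
    ¬ IsUnit (leftAddRight ρ (corner P V) - 2) := by
  have hP' := isStarProjection_of_mem_Gr hP₀ hP
  have hV' : ‖(V : A)‖ = 1 := hV
  have : Nontrivial A := nontrivial_of_ne (V : A) 0 fun h => by simp [h] at hV'
  -- the self-adjoint contraction `h` with `[V, P] = i h`
  let h : A := -(Complex.I • gen P V)
  have hv : gen P V = Complex.I • h := by simp [h, smul_smul]
  have hh : IsSelfAdjoint h := by
    simp [h, IsSelfAdjoint, star_gen hP' V.2]
  have hn : ‖h‖ = 1 := by
    rw [norm_neg, norm_smul, norm_gen hP' V.2.2, hV', Complex.norm_I, one_mul]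
  have hε : symmetry P * h = -(h * symmetry P) := by
    simp only [h, mul_neg, neg_mul, mul_smul_comm, smul_mul_assoc, symmetry_mul_gen V.2.2, smul_neg]
  have hepi := isEpiconjugate_pi_div_two hP' V hh hn hv hε
  refine ⟨⟨by positivity, fun hinv => hepi hinv.bijective.2, fun t ht ht' =>
    not_isConjugate_of_lt hP' V hh hn.le hv (by rwa [abs_of_pos ht])⟩, ?_, fun _ => hepi, ?_⟩
  · ext T
    rw [Set.mem_ofPred_eq, exists_mem_A₀_iff ρ hρ]
    constructor
    · rintro ⟨X, hX, rfl⟩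
      rw [Set.mem_ofPred_eq, dExp_pi_div_two_eq_zero_iff hP' V hh hn.le hv,
        gen_condition_iff hP' V.2 X.2] at hX
      obtain ⟨z, hz, hzs, hXz⟩ := hX
      exact ⟨z, hz, hzs, congrArg ρ hXz⟩
    · rintro ⟨z, hz, hzs, rfl⟩
      have hmem := (corner_mul_sub_mem_tangentSpace hP' hz hzs).2.2
      refine ⟨⟨_, hmem⟩, ?_, rfl⟩
      rw [Set.mem_ofPred_eq, dExp_pi_div_two_eq_zero_iff hP' V hh hn.le hv,
        gen_condition_iff hP' V.2 hmem]
      exact ⟨z, hz, hzs, rfl⟩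
  · refine not_isUnit_leftAddRight_sub_two ρ hρ ?_
    let _ : PartialOrder A := CStarAlgebra.spectralOrder A
    have : StarOrderedRing A := CStarAlgebra.spectralOrderedRing A
    have h1 := CStarAlgebra.norm_mem_spectrum_of_nonneg (a := absVal (corner P (V : A)))
      (cfc_nonneg fun x _ => Real.sqrt_nonneg x)
    rwa [norm_absVal, norm_corner hP' V.2, hV'] at h1
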